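/- Let $d\ge 2$, and consider bond percolation on the cubic lattice $\mathbb{Z}^d$, in which each nearest-neighbour edge is open with probability $p\in[0,1]$ and closed otherwise, independently; write $\mathbb{P}_p$ for the corresponding product measure. Let $X$ be the set of vertices of $\mathbb{Z}^d$ that do not lie in an infinite open cluster, regarded as an induced subgraph of the lattice, and let $\mathcal{T}$ be the event that $X$ has an infinite connected component. A plaquette is a $(d-1)$-dimensional face of a unit cube centred at a vertex of $\mathbb{Z}^d$. Each edge crosses exactly one plaquette, its dual, and a plaquette is open if and only if the edge to which it is dual is closed. Two plaquettes are adjacent if they share a $(d-2)$-dimensional face. A surface is a set of plaquettes that is connected with respect to this adjacency and such that every $(d-2)$-dimensional face lies in an even number of its elements. Let $\mathcal{S}$ be the event that there exists an infinite surface all of whose plaquettes are open. Let $p_{\rm fin}=\sup\{p\in[0,1]:\mathbb{P}_p(\mathcal{T})>0\}$ and $p_{\rm surf}=\sup\{p\in[0,1]:\mathbb{P}_p(\mathcal{S})>0\}$. These are the critical points of the two events: $p_{\rm fin}, p_{\rm surf}\in[0,1]$; $\mathbb{P}_p(\mathcal{T})$ equals $1$ for $p<p_{\rm fin}$ and $0$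 for $p>p_{\rm fin}$; and $\mathbb{P}_p(\mathcal{S})$ equals $1$ for $p<p_{\rm surf}$ and $0$ for $p>p_{\rm surf}$. Moreover $$p_{\rm fin}\le p_{\rm surf}.$$ Furthermore, in every configuration in which the complement of some infinite open cluster has an infinite connected component, there exists an infinite surface of open plaquettes. -/

import Mathlib

namespace PlaquettePercolation

/-! ### Facets of the cubic lattice -/

/-- Vertices of `ℤ^d`. -/
abbrev Vertex (d : ℕ) : Type := Fin d → ℤ

/-- A facet `x + (A_1 × ⋯ × A_d)`, where `x` is `base` and `A_i` is `{0,1}` for `i ∈ dirs` and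
`{0}` otherwise. Both are determined by the point set `Facet.verts`. -/
@[ext]
structure Facet (d : ℕ) where
  /-- the lowest corner `x` -/
  base : Vertex d
  /-- the coordinates `i` for which `A_i = {0,1}` -/
  dirs : Finset (Fin d)

namespace Facet

variable {d : ℕ}

/-- `F` is a `k`-facet for `k = F.dim`. -/
def dim (F : Facet d) : ℕ := F.dirs.card

/-- The facet as a subset of `ℤ^d`. -/
def verts (F : Facet d) : Set (Vertex d) :=
  {v | ∀ i, v i = F.base i ∨ (i ∈ F.dirs ∧ v i = F.base i + 1)}

/-- Two facets of different dimensions are incident if one is a subset of the other. -/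
def Incident (F G : Facet d) : Prop :=
  F.dim ≠ G.dim ∧ (F.verts ⊆ G.verts ∨ G.verts ⊆ F.verts)

/-- The dual of a facet of `ℤ^d`. Facets of the dual lattice `ℤ^d + (1/2, …, 1/2)` are the
translates by `(1/2, …, 1/2)` of facets of `ℤ^d`, and a facet `G : Facet d` is used to denote the
dual facet `G + (1/2, …, 1/2)`. The dual of `F` is obtained from `F` by replacing every factor
`{0,1}` by `{1/2}`, and every factor `{0}` by `{-1/2, 1/2} = 1/2 + (-1 + {0,1})`. -/
def dual (F : Facet d) : Facet d where
  base := fun i => if i ∈ F.dirs then F.base i else F.base i - 1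
  dirs := F.dirsᶜ

/-- The centre of mass of a facet of `ℤ^d`. -/
noncomputable def centre (F : Facet d) (i : Fin d) : ℝ :=
  F.base i + if i ∈ F.dirs then 1 / 2 else 0

/-- A facet and its dual (recall the translation by `1/2`) have the same centre of mass. -/
theorem centre_dual (F : Facet d) (i : Fin d) : F.dual.centre i + 1 / 2 = F.centre i := by
  by_cases h : i ∈ F.dirs
  · simp [centre, dual, h]
  · simp only [centre, dual, h, Finset.mem_compl, not_false_eq_true, if_true, if_false]
    push_cast
    ring

end Facet

/-! ### Edges, the lattice and its subgraphs -/

/-- Edges of `ℤ^d`: the pair `(x, i)` is the `1`-facet `{x, x + e_i}`. -/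
abbrev Edge (d : ℕ) : Type := Vertex d × Fin d

/-- The edge as a `1`-facet. -/
def Edge.toFacet {d : ℕ} (e : Edge d) : Facet d := ⟨e.1, {e.2}⟩

/-- The edge as an unordered pair of vertices. -/
def Edge.ends {d : ℕ} (e : Edge d) : Sym2 (Vertex d) := s(e.1, e.1 + Pi.single e.2 1)

/-- The graph on `ℤ^d` whose edges are the members of `E`. -/
def edgeGraph {d : ℕ} (E : Set (Edge d)) : SimpleGraph (Vertex d) where
  Adj x y := ∃ e ∈ E, Edge.ends e = s(x, y)
  symm := ⟨fun x y ⟨e, he, h⟩ => ⟨e, he, h.trans Sym2.eq_swap⟩⟩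
  loopless := ⟨by
    rintro x ⟨e, -, h⟩
    rw [Edge.ends, Sym2.eq_iff] at h
    have h' : e.1 = x ∧ e.1 + Pi.single e.2 1 = x := h.elim id id
    have h1 := congrFun (h'.2.trans h'.1.symm) e.2
    simp at h1⟩

/-- The cubic lattice. -/
def lattice (d : ℕ) : SimpleGraph (Vertex d) := edgeGraph Set.univ

/-- The subgraph of the lattice induced by `U` has an infinite connected component. -/
def HasInfiniteComponent {d : ℕ} (U : Set (Vertex d)) : Prop :=
  ∃ C : ((lattice d).induce U).ConnectedComponent, C.supp.Infinite

/-! ### Plaquettes and surfaces -/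

/-- Two plaquettes are adjacent if some `(d-2)`-facet is incident to both. -/
def plaquetteGraph (d : ℕ) : SimpleGraph (Facet d) where
  Adj π₁ π₂ := π₁ ≠ π₂ ∧ π₁.dim + 1 = d ∧ π₂.dim + 1 = d ∧
    ∃ f : Facet d, f.dim + 2 = d ∧ f.Incident π₁ ∧ f.Incident π₂
  symm := ⟨fun _ _ ⟨h, h₁, h₂, f, hf, hf₁, hf₂⟩ => ⟨h.symm, h₂, h₁, f, hf, hf₂, hf₁⟩⟩
  loopless := ⟨fun _ h => h.1 rfl⟩

/-- The boundary of a set of plaquettes: the `(d-2)`-facets incident to an odd number of its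
elements. -/
def boundary {d : ℕ} (P : Set (Facet d)) : Set (Facet d) :=
  {f | f.dim + 2 = d ∧ Odd {π | π ∈ P ∧ f.Incident π}.ncard}

/-- A surface is a connected set of plaquettes with empty boundary. -/
def IsSurface {d : ℕ} (P : Set (Facet d)) : Prop :=
  (∀ π ∈ P, π.dim + 1 = d) ∧ ((plaquetteGraph d).induce P).Connected ∧ boundary P = ∅

/-! ### Bond percolation -/

/-- Configurations: the edge `e` is open if `ω e = true`, and closed otherwise. -/
abbrev Config (d : ℕ) : Type := Edge d → Bool

/-- The product measure under which every edge is open with probability `p`. -/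
noncomputable def perc (d : ℕ) (p : unitInterval) : MeasureTheory.Measure (Config d) :=
  MeasureTheory.Measure.infinitePi fun _ : Edge d =>
    ProbabilityTheory.bernoulliMeasure true false p

/-- The graph of open edges. -/
def openGraph {d : ℕ} (ω : Config d) : SimpleGraph (Vertex d) := edgeGraph {e | ω e = true}

/-- The vertex set of the open cluster at `x`. -/
def cluster {d : ℕ} (ω : Config d) (x : Vertex d) : Set (Vertex d) :=
  {y | (openGraph ω).Reachable x y}

/-- The set `X` of vertices that do not lie in an infinite open cluster. -/
def finiteClusters {d : ℕ} (ω : Config d) : Set (Vertex d) := {x | (cluster ω x).Finite}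

/-- The open plaquettes of the dual lattice: the duals of the closed edges. -/
def openPlaquettes {d : ℕ} (ω : Config d) : Set (Facet d) :=
  {π | ∃ e : Edge d, ω e = false ∧ (Edge.toFacet e).dual = π}

/-- The event that there is an infinite surface of open plaquettes. -/
def surfaceEvent (d : ℕ) : Set (Config d) :=
  {ω | ∃ P : Set (Facet d), P ⊆ openPlaquettes ω ∧ P.Infinite ∧ IsSurface P}

/-- The event that `X` has an infinite connected component. -/
def finiteClustersEvent (d : ℕ) : Set (Config d) :=
  {ω | HasInfiniteComponent (finiteClusters ω)}

/-- The supremum of the parameters for which the event `A` has positive probability. -/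
noncomputable def criticalPoint {d : ℕ} (A : Set (Config d)) : ℝ :=
  sSup {p : ℝ | ∃ h : p ∈ unitInterval, 0 < perc d ⟨p, h⟩ A}

/-- `c ∈ [0,1]`, and the event `A` has probability `1` for `p < c` and `0` for `p > c`. -/
def IsThreshold {d : ℕ} (A : Set (Config d)) (c : ℝ) : Prop :=
  c ∈ Set.Icc (0 : ℝ) 1 ∧ ∀ p : unitInterval,
    ((p : ℝ) < c → ∀ᵐ ω ∂(perc d p), ω ∈ A) ∧ (c < (p : ℝ) → ∀ᵐ ω ∂(perc d p), ω ∉ A)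

/-- The critical point for the existence of an infinite component of `X`. -/
noncomputable def pFin (d : ℕ) : ℝ := criticalPoint (finiteClustersEvent d)

/-- The critical point for the existence of an infinite open surface. -/
noncomputable def pSurf (d : ℕ) : ℝ := criticalPoint (surfaceEvent d)

end PlaquettePercolation

/-! Plaquettes are replaced by the edges dual to them: adjacency becomes membership of a common unit
square, and empty boundary becomes even parity on every unit square. Modulo 2 this parity is a
cocycle condition, and cocycles on `ℤ^d` are coboundaries, so the even sets of edges are exactly the
cuts (`evenOnSquares_cut`, `EvenOnSquares.exists_eq_cut`). If both sides of a cut are connected, so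
is the cut (`induce_cut_connected`): a part of it closed under adjacency is again even, hence the
cut of some `V`, and `V` cannot split either side.

Let `U` be infinite and connected with only closed edges in its cut, and let `W` be an infinite
component of its complement. Then the cut of `W` lies in that of `U`, both sides of it are connected
and infinite, and since `d ≥ 2` it is infinite. Its dual is the required surface
(`mem_surfaceEvent_of_closed_cut`). Taking an infinite cluster for `U` gives the deterministic
claim.

For the inequality, suppose `pSurf < q < p < pFin`. At `p` there is almost surely an infinite
component of `X` but no infinite surface. An infinite cluster would have that component in its
complement and so produce a surface; hence all clusters are finite. Sharpness, by the argument of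
Duminil-Copin and Tassion (`exists_boundarySum_lt_one`), and the iterated Simon inequality
(`perc_linked_le_pow`) give exponential decay of connection probabilities at `q`. With positive
probability no cluster then meets both of two distant opposite rays of an axis. The union of the
clusters meeting one ray serves as `U`, the other ray lies in its complement, and a surface appears
(`perc_surfaceEvent_pos`), contradicting `q > pSurf`.

Both events are decreasing and translation invariant, so the zero-one law makes their critical
points thresholds. Measurability of the surface event rests on compactness, since it quantifies over
uncountably many sets of edges. -/

namespace PlaquettePercolation
open Set MeasureTheory ProbabilityTheory

/-! ### Components of induced subgraphs -/

section Graph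
variable {V : Type*} {G : SimpleGraph V}

/-- The vertices that can be reached from `x` by steps of `G` that end in `U`. -/
def compOn (G : SimpleGraph V) (U : Set V) (x : V) : Set V :=
  {y | Relation.ReflTransGen (fun a b => G.Adj a b ∧ b ∈ U) x y}

theorem self_mem_compOn (U : Set V) (x : V) : x ∈ compOn G U x := Relation.ReflTransGen.refl

theorem compOn_subset {U : Set V} {x : V} (hx : x ∈ U) : compOn G U x ⊆ U := by
  intro y hy
  induction hy with
  | refl => exact hx
  | tail _ h _ => exact h.2

theorem mem_compOn_of_adj {U : Set V} {x a b : V} (ha : a ∈ compOn G U x) (h : G.Adj a b)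
    (hb : b ∈ U) : b ∈ compOn G U x := Relation.ReflTransGen.tail ha ⟨h, hb⟩

theorem compOn_mono {U U' : Set V} (h : U ⊆ U') (x : V) : compOn G U x ⊆ compOn G U' x := by
  intro y hy
  induction hy with
  | refl => exact self_mem_compOn _ _
  | tail _ hab ih => exact mem_compOn_of_adj ih hab.1 (h hab.2)

theorem compOn_subset_of_closed {U A : Set V} {x : V} (hx : x ∈ A)
    (hA : ∀ a ∈ A, ∀ b ∈ U, G.Adj a b → b ∈ A) : compOn G U x ⊆ A := by
  intro y hy
  induction hy with
  | refl => exact hx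
  | tail _ h ih => exact hA _ ih _ h.2 h.1

theorem mem_compOn_symm {U : Set V} {x y : V} (hx : x ∈ U) (h : y ∈ compOn G U x) :
    x ∈ compOn G U y := by
  have : y ∈ {y | x ∈ compOn G U y} := by
    induction h with
    | refl => exact self_mem_compOn _ _
    | tail h₁ h ih =>
      exact Relation.ReflTransGen.trans
        (Relation.ReflTransGen.single ⟨h.1.symm, compOn_subset hx h₁⟩) ih
  exact this

/-- Quantifying over finite sets replaces infinitude by countably many conditions on membership in
`U`, which is what the measurability proofs need. -/
theorem infinite_compOn_iff {U : Set V} {x : V} (hx : x ∈ U) :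
    (compOn G U x).Infinite ↔
      ∀ F : Finset V, x ∈ F → (∀ a ∈ F, a ∈ U) → ∃ a ∈ F, ∃ b ∈ U, b ∉ F ∧ G.Adj a b := by
  constructor
  · intro h F hxF hF
    by_contra! hc
    refine h (F.finite_toSet.subset (compOn_subset_of_closed hxF ?_))
    intro a ha b hb hab
    by_contra hbF
    exact hc a ha b hb hbF hab
  · intro h hfin
    obtain ⟨a, ha, b, hb, hbF, hab⟩ := h hfin.toFinset (by simpa using self_mem_compOn U x)
      (fun a ha => compOn_subset hx (by simpa using ha))
    exact hbF (by simpa using mem_compOn_of_adj (by simpa using ha) hab hb)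

/-- This form of connectedness, with no proper closed part, lets parity arguments be applied to the
closed part `A`. -/
theorem induce_connected_iff {K : Set V} :
    (G.induce K).Connected ↔ K.Nonempty ∧
      ∀ A ⊆ K, A.Nonempty → (∀ a ∈ A, ∀ b ∈ K, G.Adj a b → b ∈ A) → K ⊆ A := by
  constructor
  · intro h
    refine ⟨⟨_, h.nonempty.some.2⟩, ?_⟩
    rintro A hA ⟨a, ha⟩ hcl b hb
    obtain ⟨w⟩ := h.preconnected ⟨a, hA ha⟩ ⟨b, hb⟩
    have key : ∀ u v : K, (G.induce K).Walk u v → u.1 ∈ A → v.1 ∈ A := by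
      intro u v w
      induction w with
      | nil => exact id
      | cons hadj _ ih => exact fun hu => ih (hcl _ hu _ (Subtype.prop _) hadj)
    exact key _ _ w ha
  · rintro ⟨⟨x, hx⟩, h⟩
    have : Nonempty K := ⟨⟨x, hx⟩⟩
    refine ⟨fun u v => ?_⟩
    have := h {y | ∃ hy : y ∈ K, (G.induce K).Reachable u ⟨y, hy⟩} (fun y hy => hy.1)
      ⟨u, u.2, SimpleGraph.Reachable.refl _⟩ ?_ v.2
    · exact this.2
    · rintro a ⟨ha, hr⟩ b hb hab
      exact ⟨hb, hr.trans (SimpleGraph.Adj.reachable (by simpa using hab))⟩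

theorem induce_compOn_connected {U : Set V} {x : V} (hx : x ∈ U) :
    (G.induce (compOn G U x)).Connected := by
  rw [induce_connected_iff]
  refine ⟨⟨x, self_mem_compOn U x⟩, ?_⟩
  rintro A hA ⟨a, ha⟩ hcl
  have h1 : compOn G U a ⊆ A := by
    refine compOn_subset_of_closed ha fun b hb c hc hbc => ?_
    exact hcl b hb c (mem_compOn_of_adj (hA hb) hbc hc) hbc
  refine compOn_subset_of_closed (h1 (mem_compOn_symm hx (hA ha))) fun b hb c hc hbc => ?_
  exact hcl b hb c (mem_compOn_of_adj (hA hb) hbc hc) hbc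

theorem compOn_eq_of_connected {K : Set V} (h : (G.induce K).Connected) {x : V} (hx : x ∈ K) :
    compOn G K x = K :=
  (compOn_subset hx).antisymm ((induce_connected_iff.1 h).2 _ (compOn_subset hx)
    ⟨x, self_mem_compOn _ _⟩ fun _ ha _ hb hab => mem_compOn_of_adj ha hab hb)

theorem exists_infinite_component_iff {U : Set V} :
    (∃ C : (G.induce U).ConnectedComponent, C.supp.Infinite) ↔
      ∃ x ∈ U, (compOn G U x).Infinite := by
  have key : ∀ x : U, compOn G U x = Subtype.val '' ((G.induce U).connectedComponentMk x).supp := by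
    intro x
    apply Subset.antisymm
    · refine compOn_subset_of_closed ⟨x, by simp⟩ ?_
      rintro _ ⟨a, ha, rfl⟩ b hb hab
      refine ⟨⟨b, hb⟩, ?_, rfl⟩
      rw [SimpleGraph.ConnectedComponent.mem_supp_iff, SimpleGraph.ConnectedComponent.eq] at ha ⊢
      exact (SimpleGraph.Adj.reachable (G := G.induce U) (u := ⟨b, hb⟩) (v := a)
        (by simpa using hab.symm)).trans ha
    · rintro _ ⟨a, ha, rfl⟩
      rw [SimpleGraph.ConnectedComponent.mem_supp_iff, SimpleGraph.ConnectedComponent.eq] at ha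
      obtain ⟨w⟩ := ha.symm
      have key : ∀ u v : U, (G.induce U).Walk u v → u.1 ∈ compOn G U x → v.1 ∈ compOn G U x := by
        intro u v w
        induction w with
        | nil => exact id
        | cons hadj _ ih => exact fun hu => ih (mem_compOn_of_adj hu hadj (Subtype.prop _))
      exact key _ _ w (self_mem_compOn _ _)
  constructor
  · rintro ⟨C, hC⟩
    induction C using SimpleGraph.ConnectedComponent.ind with
    | _ v =>
      refine ⟨v, v.2, ?_⟩
      rw [key]
      exact hC.image Subtype.val_injective.injOn
  · rintro ⟨x, hx, h⟩
    refine ⟨(G.induce U).connectedComponentMk ⟨x, hx⟩, ?_⟩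
    rw [key ⟨x, hx⟩] at h
    exact h.of_image _

end Graph

variable {d : ℕ}

theorem hasInfiniteComponent_iff {U : Set (Vertex d)} :
    HasInfiniteComponent U ↔ ∃ x ∈ U, (compOn (lattice d) U x).Infinite :=
  exists_infinite_component_iff

theorem HasInfiniteComponent.mono {U U' : Set (Vertex d)} (h : U ⊆ U')
    (hU : HasInfiniteComponent U) : HasInfiniteComponent U' := by
  rw [hasInfiniteComponent_iff] at *
  obtain ⟨x, hx, hi⟩ := hU
  exact ⟨x, h hx, hi.mono (compOn_mono h x)⟩

/-! ### The lattice -/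

/-- The upper end of an edge. -/
def Edge.top (e : Edge d) : Vertex d := e.1 + Pi.single e.2 1

theorem edgeGraph_adj {E : Set (Edge d)} {x y : Vertex d} :
    (edgeGraph E).Adj x y ↔ ∃ e ∈ E, (e.1 = x ∧ e.top = y) ∨ (e.1 = y ∧ e.top = x) := by
  simp only [edgeGraph, Edge.ends, Edge.top, Sym2.eq_iff]

theorem lattice_adj {x y : Vertex d} :
    (lattice d).Adj x y ↔ ∃ e : Edge d, (e.1 = x ∧ e.top = y) ∨ (e.1 = y ∧ e.top = x) := by
  simp [lattice, edgeGraph_adj]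

theorem lattice_adj_top (e : Edge d) : (lattice d).Adj e.1 e.top :=
  lattice_adj.2 ⟨e, Or.inl ⟨rfl, rfl⟩⟩

theorem edgeGraph_le_lattice (E : Set (Edge d)) : edgeGraph E ≤ lattice d := by
  intro x y h
  obtain ⟨e, -, h⟩ := edgeGraph_adj.1 h
  exact lattice_adj.2 ⟨e, h⟩

theorem iff_update_of_step {Q : Vertex d → Prop} (y : Vertex d) (j : Fin d)
    (h : ∀ n : ℤ, Q (Function.update y j n) ↔ Q (Function.update y j n + Pi.single j 1)) (n : ℤ) :
    Q y ↔ Q (Function.update y j n) := by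
  have h' : ∀ n : ℤ, Q (Function.update y j n) ↔ Q (Function.update y j (n + 1)) := by
    intro n
    rw [h n]
    have : Function.update y j n + Pi.single j 1 = Function.update y j (n + 1) := by
      ext k
      by_cases hk : k = j
      · subst hk; simp
      · simp [hk]
    rw [this]
  have key : ∀ n : ℤ, Q (Function.update y j (y j)) ↔ Q (Function.update y j n) := by
    intro n
    refine Int.inductionOn' n (y j) Iff.rfl (fun k _ ih => ih.trans (h' k)) fun k _ ih => ?_
    exact ih.trans (by simpa using (h' (k - 1)).symm)
  simpa using key n

/-- Only directions in `s` are used and the other coordinates stay those of `x`, so the lemma also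
applies on a single hyperplane. -/
theorem iff_of_step {Q : Vertex d → Prop} {x : Vertex d} (s : Finset (Fin d))
    (h : ∀ y, (∀ k ∉ s, y k = x k) → ∀ i ∈ s, (Q y ↔ Q (y + Pi.single i 1))) :
    ∀ y, (∀ k ∉ s, y k = x k) → (Q y ↔ Q x) := by
  classical
  induction s using Finset.induction_on with
  | empty =>
    intro y hy
    rw [show y = x from funext fun k => hy k (by simp)]
  | insert j s hj ih =>
    intro y hy
    have h1 : Q (Function.update y j (x j)) ↔ Q x := by
      refine ih (fun z hz i hi => h z (fun k hk => hz k fun hk' => hk (by simp [hk'])) i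
        (by simp [hi])) _ fun k hk => ?_
      by_cases hkj : k = j
      · subst hkj; simp
      · simpa [hkj] using hy k (by simp [hk, hkj])
    rw [← h1]
    refine iff_update_of_step y j (fun n => h _ (fun k hk => ?_) j (by simp)) _
    have hkj : k ≠ j := fun e => hk (by simp [e])
    simpa [hkj] using hy k hk

theorem iff_of_step_univ {Q : Vertex d → Prop} (h : ∀ e : Edge d, Q e.1 ↔ Q e.top)
    (x y : Vertex d) : Q x ↔ Q y :=
  iff_of_step Finset.univ (fun y _ i _ => h (y, i)) x (by simp)

/-! ### Cocycles and cuts -/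

theorem exists_antidifference {A : Type*} [AddCommGroup A] (h : ℤ → A) :
    ∃ H : ℤ → A, ∀ n, H (n + 1) = H n + h n := by
  -- For each sign of `n` one of the two sums is empty.
  refine ⟨fun n => ∑ k ∈ Finset.Ico 0 n, h k - ∑ k ∈ Finset.Ico n 0, h k, fun n => ?_⟩
  beta_reduce
  rcases le_or_gt 0 n with hn | hn
  · have h1 : Finset.Ico 0 (n + 1) = insert n (Finset.Ico 0 n) := by ext k; simp; omega
    rw [h1, Finset.sum_insert (by simp), Finset.Ico_eq_empty (a := n + 1) (by omega),
      Finset.Ico_eq_empty (a := n) (by omega)]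
    simp [add_comm]
  · have h1 : Finset.Ico n 0 = insert n (Finset.Ico (n + 1) 0) := by ext k; simp; omega
    rw [h1, Finset.sum_insert (by simp), Finset.Ico_eq_empty (b := n + 1) (by omega),
      Finset.Ico_eq_empty (b := n) (by omega)]
    simp

/-- A discrete Poincaré lemma, by induction on the set of directions in which `V` is already a
potential. To add a direction `j`, the error of `V` along `j` is summed along lines parallel to `j`.
By the cocycle condition this error is invariant in the old directions, so the correction does not
spoil them. -/
theorem exists_potential_of_cocycle {A : Type*} [AddCommGroup A] (f : Edge d → A)
    (hf : ∀ (x : Vertex d) (i j : Fin d), i ≠ j →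
      f (x, i) + f (x + Pi.single i 1, j) = f (x, j) + f (x + Pi.single j 1, i)) :
    ∃ V : Vertex d → A, ∀ e : Edge d, V e.top = V e.1 + f e := by
  classical
  suffices H : ∀ s : Finset (Fin d), ∃ V : Vertex d → A, ∀ x, ∀ i ∈ s,
      V (x + Pi.single i 1) = V x + f (x, i) by
    obtain ⟨V, hV⟩ := H Finset.univ
    exact ⟨V, fun e => hV e.1 e.2 (Finset.mem_univ _)⟩
  intro s
  induction s using Finset.induction_on with
  | empty => exact ⟨0, by simp⟩
  | insert j s hj ih =>
    obtain ⟨V, hV⟩ := ih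
    choose H hH using fun h : ℤ → A => exists_antidifference h
    let g : Vertex d → A := fun x => f (x, j) - (V (x + Pi.single j 1) - V x)
    have hg : ∀ x, ∀ i ∈ s, g (x + Pi.single i 1) = g x := by
      intro x i hi
      have hij : i ≠ j := fun e => hj (e ▸ hi)
      have h1 := hf x i j hij
      have h2 := hV x i hi
      have h3 := hV (x + Pi.single j 1) i hi
      simp only [g]
      rw [add_right_comm x, h3, h2, sub_eq_sub_iff_add_eq_add]
      rw [← sub_eq_zero] at h1 ⊢
      rw [← h1]
      abel
    let line : Vertex d → ℤ → A := fun x n => g (Function.update x j n)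
    refine ⟨fun x => V x + H (line x) (x j), fun x i hi => ?_⟩
    beta_reduce
    rcases Finset.mem_insert.1 hi with rfl | hi
    · have hl : line (x + Pi.single i 1) = line x := by
        funext n
        simp only [line]
        congr 1
        ext k
        by_cases hk : k = i
        · subst hk; simp
        · simp [hk]
      rw [hl]
      simp only [Pi.add_apply, Pi.single_eq_same, hH]
      simp only [line, Function.update_eq_self, g]
      abel
    · have hij : i ≠ j := fun e => hj (e ▸ hi)
      have hl : line (x + Pi.single i 1) = line x := by
        funext n
        simp only [line]
        refine (congrArg g ?_).trans (hg (Function.update x j n) i hi)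
        ext k
        by_cases hk : k = j
        · subst hk; simp [hij.symm]
        · simp [hk]
      rw [hl, hV x i hi]
      simp only [Pi.add_apply, Pi.single_eq_of_ne hij.symm, add_zero]
      abel

/-- The edges with exactly one end in `W`. -/
def cut (W : Set (Vertex d)) : Set (Edge d) := {e | ¬ (e.1 ∈ W ↔ e.top ∈ W)}

/-- The four edges of the unit square at `x` with directions `i` and `j`. -/
def squareEdges (x : Vertex d) (i j : Fin d) : Finset (Edge d) :=
  {(x, i), (x + Pi.single j 1, i), (x, j), (x + Pi.single i 1, j)}

/-- Every unit square has an even number of edges in `E`. -/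
def EvenOnSquares (E : Set (Edge d)) : Prop :=
  ∀ (x : Vertex d) (i j : Fin d), i ≠ j → Even (E ∩ squareEdges x i j).ncard

/-- Two edges are adjacent if they lie in a common unit square. -/
def squareGraph (d : ℕ) : SimpleGraph (Edge d) where
  Adj e e' := e ≠ e' ∧ ∃ (x : Vertex d) (i j : Fin d), i ≠ j ∧
    e ∈ squareEdges x i j ∧ e' ∈ squareEdges x i j
  symm := ⟨fun _ _ ⟨h, x, i, j, hij, h₁, h₂⟩ => ⟨h.symm, x, i, j, hij, h₂, h₁⟩⟩
  loopless := ⟨fun _ h => h.1 rfl⟩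

theorem add_single_ne (x : Vertex d) (i : Fin d) : x + Pi.single i 1 ≠ x := by
  intro h
  simpa using congrFun h i

open Classical in
/-- The indicator of `E` with values in `ℤ/2`. -/
noncomputable def indicatorTwo (E : Set (Edge d)) (e : Edge d) : ZMod 2 := if e ∈ E then 1 else 0

theorem indicatorTwo_eq_zero_iff {E : Set (Edge d)} {e : Edge d} :
    indicatorTwo E e = 0 ↔ e ∉ E := by
  unfold indicatorTwo
  split_ifs <;> simp_all

/-- Over `ℤ/2` signs do not matter, so parity on the four edges of a square is the cocycle condition
for the indicator. -/
theorem evenOnSquares_iff {E : Set (Edge d)} : EvenOnSquares E ↔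
    ∀ (x : Vertex d) (i j : Fin d), i ≠ j →
      indicatorTwo E (x, i) + indicatorTwo E (x + Pi.single i 1, j) =
      indicatorTwo E (x, j) + indicatorTwo E (x + Pi.single j 1, i) := by
  classical
  refine forall_congr' fun x => forall_congr' fun i => forall_congr' fun j =>
    forall_congr' fun hij => ?_
  have h1 : E ∩ (squareEdges x i j : Set (Edge d)) = ((squareEdges x i j).filter (· ∈ E) :) := by
    ext e; simp [and_comm]
  rw [h1, Set.ncard_coe_finset, ← ZMod.natCast_eq_zero_iff_even, Finset.card_filter]
  push_cast
  have h2 : ∀ e, (if e ∈ E then (1 : ZMod 2) else 0) = indicatorTwo E e := fun e => rfl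
  simp only [h2]
  rw [squareEdges, Finset.sum_insert, Finset.sum_insert, Finset.sum_insert, Finset.sum_singleton]
  · generalize indicatorTwo E (x, i) = a
    generalize indicatorTwo E (x, j) = b
    generalize indicatorTwo E (x + Pi.single i 1, j) = c
    generalize indicatorTwo E (x + Pi.single j 1, i) = e
    revert a b c e
    decide
  · simp [(add_single_ne x i).symm]
  · simp [hij]
  · simp [hij, (add_single_ne x j).symm]

theorem evenOnSquares_cut (W : Set (Vertex d)) : EvenOnSquares (cut W) := by
  classical
  rw [evenOnSquares_iff]
  intro x i j hij
  let χ : Vertex d → ZMod 2 := fun y => if y ∈ W then 1 else 0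
  have h : ∀ e, indicatorTwo (cut W) e = χ e.1 + χ e.top := by
    intro e
    simp only [indicatorTwo, cut, mem_ofPred_eq, χ]
    by_cases h1 : e.1 ∈ W <;> by_cases h2 : e.top ∈ W <;> simp [h1, h2]
    decide
  simp only [h, Edge.top, add_right_comm x (Pi.single j 1)]
  generalize χ x = a
  generalize χ (x + Pi.single i 1) = b
  generalize χ (x + Pi.single j 1) = c
  generalize χ (x + Pi.single i 1 + Pi.single j 1) = e
  revert a b c e
  decide

/-- Edges of one square are pairwise adjacent, so on each square `A` has either no edge or all those
of `E`. -/
theorem EvenOnSquares.of_closed {E A : Set (Edge d)} (hE : EvenOnSquares E) (hA : A ⊆ E)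
    (h : ∀ a ∈ A, ∀ b ∈ E, (squareGraph d).Adj a b → b ∈ A) : EvenOnSquares A := by
  intro x i j hij
  rcases (A ∩ squareEdges x i j).eq_empty_or_nonempty with h0 | ⟨a, ha, has⟩
  · simp [h0]
  · have : A ∩ squareEdges x i j = E ∩ squareEdges x i j := by
      refine Subset.antisymm (inter_subset_inter_left _ hA) ?_
      rintro b ⟨hb, hbs⟩
      refine ⟨?_, hbs⟩
      by_cases hab : a = b
      · exact hab ▸ ha
      · exact h a ha b hb ⟨hab, x, i, j, hij, has, hbs⟩
    rw [this]
    exact hE x i j hij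

/-- A set of edges that is even on squares is a cut. -/
theorem EvenOnSquares.exists_eq_cut {E : Set (Edge d)} (hE : EvenOnSquares E) :
    ∃ W, E = cut W := by
  obtain ⟨V, hV⟩ := exists_potential_of_cocycle (indicatorTwo E) (evenOnSquares_iff.1 hE)
  -- With values in `ℤ/2`, the potential changes across an edge exactly when the edge is in `E`.
  refine ⟨{x | V x = 0}, ?_⟩
  ext e
  have h := hV e
  rw [← not_iff_not, ← indicatorTwo_eq_zero_iff]
  simp only [cut, mem_ofPred_eq, not_not, h]
  generalize V e.1 = a
  generalize indicatorTwo E e = b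
  revert a b
  decide

/-- If `W` and its complement are connected, then the edges between them are connected through
common squares. -/
theorem induce_cut_connected {W : Set (Vertex d)} (hne : (cut W).Nonempty)
    (h1 : ((lattice d).induce W).Connected) (h2 : ((lattice d).induce Wᶜ).Connected) :
    ((squareGraph d).induce (cut W)).Connected := by
  refine induce_connected_iff.2 ⟨hne, fun A hA hAne hcl => ?_⟩
  obtain ⟨V, rfl⟩ := ((evenOnSquares_cut W).of_closed hA hcl).exists_eq_cut
  -- No edge inside a side of the cut of `W` belongs to the smaller cut of `V`, so membership in `V`
  -- is constant on each connected side.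
  have const : ∀ K : Set (Vertex d), ((lattice d).induce K).Connected →
      (∀ e : Edge d, e.1 ∈ K → e.top ∈ K → e ∉ cut W) →
      ∀ x ∈ K, ∀ y ∈ K, (x ∈ V → y ∈ V) := by
    intro K hK hKW x hx y hy hxV
    have := (induce_connected_iff.1 hK).2 (K ∩ V) inter_subset_left ⟨x, hx, hxV⟩ ?_ hy
    · exact this.2
    · rintro a ⟨haK, haV⟩ b hbK hab
      refine ⟨hbK, ?_⟩
      obtain ⟨e, ⟨rfl, rfl⟩ | ⟨rfl, rfl⟩⟩ := lattice_adj.1 hab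
      · have := fun h => hKW e haK hbK (hA h)
        simp only [cut, mem_ofPred_eq] at this
        exact (not_not.1 this).1 haV
      · have := fun h => hKW e hbK haK (hA h)
        simp only [cut, mem_ofPred_eq] at this
        exact (not_not.1 this).2 haV
  have c1 := const W h1 fun e ha hb => by simp [cut, ha, hb]
  have c2 := const Wᶜ h2 fun e ha hb => by
    simp only [mem_compl_iff] at ha hb; simp [cut, ha, hb]
  obtain ⟨a, ha⟩ := hAne
  have haW := hA ha
  intro b hb
  simp only [cut, mem_ofPred_eq, mem_compl_iff] at *
  -- The edge `a` lies in both cuts, so `V` takes different values on the two sides, and every edge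
  -- `b` between the sides is in the cut of `V`.
  by_cases a1 : a.1 ∈ W <;> by_cases a2 : a.top ∈ W <;> by_cases b1 : b.1 ∈ W <;>
    by_cases b2 : b.top ∈ W <;> simp only [a1, a2, b1, b2, not_true_eq_false] at haW hb <;>
    grind

/-- A hyperplane on which some coordinate is at least `M` in absolute value meets no edge of the
cut, so it lies on one side. Any two such hyperplanes meet, or meet a common third one because `d ≥
2`. Hence all vertices outside a box are on the same side. -/
theorem finite_or_finite_compl_of_finite_cut (hd : 2 ≤ d) {W : Set (Vertex d)}
    (h : (cut W).Finite) : W.Finite ∨ Wᶜ.Finite := by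
  obtain ⟨M, hM⟩ : ∃ M : ℤ, ∀ e ∈ cut W, ∀ i, |e.1 i| < M := by
    have hfin : (⋃ i : Fin d, (fun e : Edge d => |e.1 i|) '' cut W).Finite :=
      Set.finite_iUnion fun i => h.image _
    obtain ⟨M, hM⟩ := hfin.bddAbove
    refine ⟨M + 1, fun e he i => Int.lt_add_one_of_le (hM ?_)⟩
    exact mem_iUnion.2 ⟨i, e, he, rfl⟩
  have step : ∀ (i : Fin d) (x y : Vertex d), M ≤ |x i| → y i = x i → (y ∈ W ↔ x ∈ W) := by
    intro i x y hx hy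
    refine iff_of_step (Q := (· ∈ W)) (x := x) (Finset.univ.erase i) ?_ y ?_
    · intro z hz j _
      have hzi : z i = x i := hz i (by simp)
      by_contra hc
      have := hM (z, j) hc i
      simp only [hzi] at this
      omega
    · intro k hk
      have : k = i := by simpa using hk
      rw [this, hy]
  have all : ∀ x y : Vertex d, (∃ i, M ≤ |x i|) → (∃ i, M ≤ |y i|) → (y ∈ W ↔ x ∈ W) := by
    rintro x y ⟨i, hi⟩ ⟨j, hj⟩
    by_cases hij : i = j
    · subst hij
      have : Nontrivial (Fin d) := Fin.nontrivial_iff_two_le.2 hd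
      obtain ⟨k, hk⟩ := exists_ne i
      -- Parallel hyperplanes are joined through the transverse hyperplane on which coordinate `k`
      -- equals `M`.
      have e1 := step i x (Function.update x k M) hi (by simp [hk.symm])
      have e2 := step i y (Function.update y k M) hj (by simp [hk.symm])
      have e3 := step k (Function.update x k M) (Function.update y k M)
        (by simpa using le_abs_self M) (by simp)
      exact e2.symm.trans (e3.trans e1)
    · have e1 := step i x (Function.update x j (y j)) hi (by simp [hij])
      have e2 := step j y (Function.update x j (y j)) hj (by simp)
      exact e2.symm.trans e1
  have hbox : {x : Vertex d | ∀ i, |x i| < M}.Finite := by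
    refine (Set.finite_Icc (fun _ : Fin d => -M) (fun _ => M)).subset fun x hx => ?_
    exact ⟨fun i => (abs_lt.1 (hx i)).1.le, fun i => (abs_lt.1 (hx i)).2.le⟩
  by_cases hW : ∃ x ∈ W, ∃ i, M ≤ |x i|
  · obtain ⟨x, hxW, hx⟩ := hW
    right
    refine hbox.subset fun y hy i => ?_
    by_contra hc
    exact hy ((all x y hx ⟨i, not_lt.1 hc⟩).2 hxW)
  · left
    refine hbox.subset fun y hy i => ?_
    by_contra hc
    exact hW ⟨y, hy, i, not_lt.1 hc⟩

/-! ### Plaquettes and edges -/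

/-- The plaquette dual to an edge. -/
def plaq (e : Edge d) : Facet d := e.toFacet.dual

theorem plaq_base (e : Edge d) (k : Fin d) :
    (plaq e).base k = if k = e.2 then e.1 k else e.1 k - 1 := by
  simp [plaq, Facet.dual, Edge.toFacet]

theorem mem_plaq_dirs (e : Edge d) (k : Fin d) : k ∈ (plaq e).dirs ↔ k ≠ e.2 := by
  simp [plaq, Facet.dual, Edge.toFacet]

theorem plaq_dim (e : Edge d) : (plaq e).dim + 1 = d := by
  have h := Finset.card_compl_add_card ({e.2} : Finset (Fin d))
  simpa [plaq, Facet.dual, Edge.toFacet, Facet.dim] using h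

theorem plaq_injective : Function.Injective (plaq (d := d)) := by
  intro e e' h
  have h2 : e.2 = e'.2 := by
    by_contra hne
    have := (mem_plaq_dirs e' e.2).2 hne
    rw [← h, mem_plaq_dirs] at this
    exact this rfl
  refine Prod.ext (funext fun k => ?_) h2
  have h1 := congrFun (congrArg Facet.base h) k
  rw [plaq_base, plaq_base, h2] at h1
  split_ifs at h1
  · exact h1
  · omega

theorem Facet.verts_subset_iff {F G : Facet d} : F.verts ⊆ G.verts ↔
    ∀ i, (F.base i = G.base i ∨ (i ∈ G.dirs ∧ F.base i = G.base i + 1)) ∧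
      (i ∈ F.dirs → i ∈ G.dirs ∧ F.base i = G.base i) := by
  constructor
  · intro h i
    have h1 : F.base ∈ G.verts := h fun k => Or.inl rfl
    refine ⟨h1 i, fun hi => ?_⟩
    have h2 : F.base + Pi.single i 1 ∈ G.verts := h fun k => by
      by_cases hk : k = i
      · subst hk; exact Or.inr ⟨hi, by simp⟩
      · exact Or.inl (by simp [hk])
    have h3 := h1 i
    have h4 := h2 i
    simp only [Pi.add_apply, Pi.single_eq_same] at h4
    grind
  · intro h v hv i
    have h1 := hv i
    have h2 := h i
    grind

/-- By dimension the face must be contained in the plaquette. The square is the dual of `f`; the `+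
1` in the directions of `f` undoes the `- 1` in `Facet.dual`. -/
theorem incident_plaq_iff {f : Facet d} {i j : Fin d} (hf : ∀ k, k ∈ f.dirs ↔ k ≠ i ∧ k ≠ j)
    (hij : i ≠ j) (hdim : f.dim + 2 = d) (e : Edge d) :
    f.Incident (plaq e) ↔
      e ∈ squareEdges (fun k => if k ∈ f.dirs then f.base k + 1 else f.base k) i j := by
  have hp := plaq_dim e
  have h1 : f.Incident (plaq e) ↔ f.verts ⊆ (plaq e).verts := by
    refine ⟨?_, fun h => ⟨by omega, Or.inl h⟩⟩
    rintro ⟨-, h | h⟩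
    · exact h
    · have : (plaq e).dim ≤ f.dim :=
        Finset.card_le_card fun k hk => ((Facet.verts_subset_iff.1 h k).2 hk).1
      omega
  obtain ⟨x, m⟩ := e
  rw [h1, Facet.verts_subset_iff]
  simp only [plaq_base, mem_plaq_dirs, squareEdges, Finset.mem_insert, Finset.mem_singleton,
    Prod.mk.injEq, funext_iff, Pi.add_apply, hf]
  constructor
  · intro h
    have hi := h i
    have hj := h j
    by_cases hmi : m = i
    · subst hmi
      have : ∀ k, k ≠ m → k ≠ j → x k = f.base k + 1 := fun k h1 h2 => by
        have := ((h k).2 ⟨h1, h2⟩).2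
        rw [if_neg h1] at this
        omega
      simp only [hij.symm, if_false, if_true, ne_eq, not_true_eq_false, false_and, and_false,
        or_false, false_imp_iff, and_true, not_false_eq_true, true_and] at hi hj
      rcases hj with hj | hj
      · right; left
        refine ⟨fun k => ?_, rfl⟩
        by_cases hkj : k = j
        · subst hkj; simp; omega
        · by_cases hkm : k = m
          · subst hkm; simp [hkj]; omega
          · simp [hkj, hkm, this]
      · left
        refine ⟨fun k => ?_, rfl⟩
        by_cases hkj : k = j
        · subst hkj; simp; omega
        · by_cases hkm : k = m
          · subst hkm; simp; omega
          · simp [hkj, hkm, this]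
    · have hmj : m = j := by
        by_contra hmj
        exact ((h m).2 ⟨hmi, hmj⟩).1 rfl
      subst hmj
      have : ∀ k, k ≠ i → k ≠ m → x k = f.base k + 1 := fun k h1 h2 => by
        have := ((h k).2 ⟨h1, h2⟩).2
        rw [if_neg h2] at this
        omega
      simp only [hij, if_false, if_true, ne_eq, not_true_eq_false, false_and, and_false,
        or_false, false_imp_iff, and_true, not_false_eq_true, true_and] at hi hj
      rcases hi with hi | hi
      · right; right; right
        refine ⟨fun k => ?_, rfl⟩
        by_cases hkj : k = i
        · subst hkj; simp; omega
        · by_cases hkm : k = m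
          · subst hkm; simp [hkj]; omega
          · simp [hkj, hkm, this]
      · right; right; left
        refine ⟨fun k => ?_, rfl⟩
        by_cases hkj : k = i
        · subst hkj; simp; omega
        · by_cases hkm : k = m
          · subst hkm; simp; omega
          · simp [hkj, hkm, this]
  · rintro (⟨h, hm⟩ | ⟨h, hm⟩ | ⟨h, hm⟩ | ⟨h, hm⟩) k <;> have hk := h k <;>
      by_cases hki : k = i <;> by_cases hkj : k = j <;> grind

theorem exists_facet_of_square (x : Vertex d) {i j : Fin d} (hij : i ≠ j) :
    ∃ f : Facet d, f.dim + 2 = d ∧ ∀ e, f.Incident (plaq e) ↔ e ∈ squareEdges x i j := by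
  let f : Facet d := ⟨fun k => if k ≠ i ∧ k ≠ j then x k - 1 else x k, {i, j}ᶜ⟩
  have hf : ∀ k, k ∈ f.dirs ↔ k ≠ i ∧ k ≠ j := by simp [f]
  have hdim : f.dim + 2 = d := by
    have h := Finset.card_compl_add_card ({i, j} : Finset (Fin d))
    simpa [f, Facet.dim, Finset.card_pair hij] using h
  refine ⟨f, hdim, fun e => ?_⟩
  rw [incident_plaq_iff hf hij hdim]
  have : (fun k => if k ∈ f.dirs then f.base k + 1 else f.base k) = x := by
    funext k
    rw [if_congr (hf k) rfl rfl]
    simp only [f]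
    split_ifs <;> simp
  rw [this]

theorem exists_square_of_facet {f : Facet d} (hf : f.dim + 2 = d) :
    ∃ (x : Vertex d) (i j : Fin d), i ≠ j ∧ ∀ e, f.Incident (plaq e) ↔ e ∈ squareEdges x i j := by
  have hc : (f.dirsᶜ).card = 2 := by
    have h := Finset.card_compl_add_card f.dirs
    simp only [Fintype.card_fin, Facet.dim] at h hf
    omega
  obtain ⟨i, j, hij, h⟩ := Finset.card_eq_two.1 hc
  refine ⟨_, i, j, hij, incident_plaq_iff (fun k => ?_) hij hf⟩
  have : k ∈ f.dirsᶜ ↔ k ∈ ({i, j} : Finset (Fin d)) := by rw [h]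
  simp only [Finset.mem_compl, Finset.mem_insert, Finset.mem_singleton] at this
  tauto

theorem plaquetteGraph_adj_plaq {e e' : Edge d} :
    (plaquetteGraph d).Adj (plaq e) (plaq e') ↔ (squareGraph d).Adj e e' := by
  constructor
  · rintro ⟨hne, -, -, f, hf, h, h'⟩
    obtain ⟨x, i, j, hij, H⟩ := exists_square_of_facet hf
    exact ⟨fun h => hne (h ▸ rfl), x, i, j, hij, (H _).1 h, (H _).1 h'⟩
  · rintro ⟨hne, x, i, j, hij, h, h'⟩
    obtain ⟨f, hf, H⟩ := exists_facet_of_square x hij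
    exact ⟨plaq_injective.ne hne, plaq_dim e, plaq_dim e', f, hf, (H _).2 h, (H _).2 h'⟩

theorem incident_image_plaq_ncard {E : Set (Edge d)} {f : Facet d} {s : Finset (Edge d)}
    (H : ∀ e, f.Incident (plaq e) ↔ e ∈ s) :
    {π | π ∈ plaq '' E ∧ f.Incident π}.ncard = (E ∩ s).ncard := by
  rw [← Set.ncard_image_of_injective _ plaq_injective]
  congr 1
  ext π
  constructor
  · rintro ⟨⟨e, he, rfl⟩, h⟩
    exact ⟨e, ⟨he, (H e).1 h⟩, rfl⟩
  · rintro ⟨e, ⟨he, h⟩, rfl⟩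
    exact ⟨⟨e, he, rfl⟩, (H e).2 h⟩

/-- Under duality, the `(d-2)`-faces and the unit squares correspond, and so do the incidences. -/
theorem isSurface_image_plaq {E : Set (Edge d)} :
    IsSurface (plaq '' E) ↔ ((squareGraph d).induce E).Connected ∧ EvenOnSquares E := by
  have iso : (squareGraph d).induce E ≃g (plaquetteGraph d).induce (plaq '' E) :=
    { toEquiv := Equiv.Set.image plaq E plaq_injective
      map_rel_iff' := by
        intro a b
        simp [plaquetteGraph_adj_plaq] }
  rw [IsSurface, iso.connected_iff]
  have hdim : ∀ π ∈ plaq '' E, π.dim + 1 = d := by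
    rintro _ ⟨e, -, rfl⟩; exact plaq_dim e
  have hb : boundary (plaq '' E) = ∅ ↔ EvenOnSquares E := by
    rw [Set.eq_empty_iff_forall_notMem]
    constructor
    · intro h x i j hij
      obtain ⟨f, hf, H⟩ := exists_facet_of_square x hij
      rw [← incident_image_plaq_ncard H, ← Nat.not_odd_iff_even]
      exact fun ho => h f ⟨hf, ho⟩
    · rintro h f ⟨hf, ho⟩
      obtain ⟨x, i, j, hij, H⟩ := exists_square_of_facet hf
      rw [incident_image_plaq_ncard H, ← Nat.not_even_iff_odd] at ho
      exact ho (h x i j hij)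
  tauto

theorem mem_surfaceEvent_iff {ω : Config d} : ω ∈ surfaceEvent d ↔
    ∃ E : Set (Edge d), (∀ e ∈ E, ω e = false) ∧ E.Infinite ∧
      ((squareGraph d).induce E).Connected ∧ EvenOnSquares E := by
  constructor
  · rintro ⟨P, hP, hinf, hs⟩
    have hPE : P = plaq '' {e | plaq e ∈ P} := by
      ext π
      constructor
      · intro h
        obtain ⟨e, -, rfl⟩ := hP h
        exact ⟨e, h, rfl⟩
      · rintro ⟨e, h, rfl⟩; exact h
    refine ⟨{e | plaq e ∈ P}, ?_, ?_, ?_⟩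
    · intro e he
      obtain ⟨e', h', h⟩ := hP he
      rwa [← plaq_injective h]
    · rw [hPE] at hinf
      exact hinf.of_image _
    · rw [hPE] at hs
      exact isSurface_image_plaq.1 hs
  · rintro ⟨E, hE, hinf, h⟩
    refine ⟨plaq '' E, ?_, hinf.image plaq_injective.injOn, isSurface_image_plaq.2 h⟩
    rintro _ ⟨e, he, rfl⟩
    exact ⟨e, hE e he, rfl⟩

/-- A connected infinite set of vertices whose cut is closed, and whose complement has an infinite
component, gives rise to an infinite open surface. -/
theorem mem_surfaceEvent_of_closed_cut (hd : 2 ≤ d) {ω : Config d} {U : Set (Vertex d)}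
    (hinf : U.Infinite) (hconn : ((lattice d).induce U).Connected)
    (hcut : ∀ e ∈ cut U, ω e = false) (h : HasInfiniteComponent Uᶜ) : ω ∈ surfaceEvent d := by
  obtain ⟨x, hx, hW⟩ := hasInfiniteComponent_iff.1 h
  set W := compOn (lattice d) Uᶜ x with hWdef
  have hWU : W ⊆ Uᶜ := compOn_subset hx
  have hUW : U ⊆ Wᶜ := fun y hy hyW => hWU hyW hy
  -- An edge leaving the component `W` of the complement of `U` can only end in `U`.
  have hcutW : cut W ⊆ cut U := by
    intro e he hU
    apply he
    have key : ∀ a b, (lattice d).Adj a b → (a ∈ U ↔ b ∈ U) → a ∈ W → b ∈ W := by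
      intro a b hab hiff haW
      exact mem_compOn_of_adj haW hab fun hb => hWU haW (hiff.2 hb)
    exact ⟨key _ _ (lattice_adj_top e) hU, key _ _ (lattice_adj_top e).symm hU.symm⟩
  have hcutinf : (cut W).Infinite := fun hfin =>
    (finite_or_finite_compl_of_finite_cut hd hfin).elim hW fun hc => hinf (hc.subset hUW)
  refine mem_surfaceEvent_iff.2 ⟨cut W, fun e he => hcut e (hcutW he), hcutinf,
    induce_cut_connected hcutinf.nonempty (induce_compOn_connected hx) ?_, evenOnSquares_cut W⟩
  obtain ⟨u, hu⟩ := hinf.nonempty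
  refine induce_connected_iff.2 ⟨⟨u, hUW hu⟩, fun A hA hAne hcl => ?_⟩
  have hstep : ∀ a b, (lattice d).Adj a b → (a ∈ A ∨ a ∈ W) → (b ∈ A ∨ b ∈ W) ∨ b ∈ U := by
    intro a b hab ha
    by_cases hbU : b ∈ U
    · exact Or.inr hbU
    · left
      rcases ha with ha | ha
      · by_cases hbW : b ∈ W
        · exact Or.inr hbW
        · exact Or.inl (hcl a ha b hbW hab)
      · exact Or.inr (mem_compOn_of_adj ha hab hbU)
  -- If `A` missed `U`, no edge could lead from `A` to `W`, since its end in `A` would then belong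
  -- to `W`. So `A` would be closed in the whole lattice and hence contain `U`.
  have hUA : U ⊆ A := by
    suffices hs : (U ∩ A).Nonempty from
      ((induce_connected_iff.1 hconn).2 (U ∩ A) inter_subset_left hs fun a ha b hb hab =>
        ⟨hb, hcl a ha.2 b (hUW hb) hab⟩).trans inter_subset_right
    by_contra hemp
    rw [Set.not_nonempty_iff_eq_empty, Set.eq_empty_iff_forall_notMem] at hemp
    obtain ⟨a, ha⟩ := hAne
    have hstepA : ∀ a b, (lattice d).Adj a b → a ∈ A → b ∈ A := by
      intro a b hab ha
      refine hcl a ha b (fun hbW => ?_) hab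
      exact hA ha (mem_compOn_of_adj hbW hab.symm fun haU => hemp a ⟨haU, ha⟩)
    have := (iff_of_step_univ (Q := (· ∈ A)) (fun e => ⟨hstepA _ _ (lattice_adj_top e),
      hstepA _ _ (lattice_adj_top e).symm⟩) a u).1 ha
    exact hemp u ⟨hu, this⟩
  -- Edges out of `W` end in `U`, which is now part of `A`; so `A ∪ W` is closed in the connected
  -- lattice.
  have hall : ∀ y, y ∈ A ∨ y ∈ W := by
    have hs : ∀ a b, (lattice d).Adj a b → (a ∈ A ∨ a ∈ W) → (b ∈ A ∨ b ∈ W) := fun a b hab ha =>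
      (hstep a b hab ha).elim id fun hb => Or.inl (hUA hb)
    intro y
    exact (iff_of_step_univ (Q := fun y => y ∈ A ∨ y ∈ W) (fun e => ⟨hs _ _ (lattice_adj_top e),
      hs _ _ (lattice_adj_top e).symm⟩) u y).1 (Or.inl (hUA hu))
  exact fun y hy => (hall y).resolve_right hy

/-! ### The percolation measure -/

instance (p : unitInterval) : IsProbabilityMeasure (perc d p) := by
  unfold perc; infer_instance

/-- Membership of `A` depends only on the edges in `I`. -/
def SupportedOn (A : Set (Config d)) (I : Set (Edge d)) : Prop :=
  ∀ ⦃ω ω' : Config d⦄, (∀ e ∈ I, ω e = ω' e) → ω ∈ A → ω' ∈ A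

open Classical in
/-- The configuration in which all edges outside `I` are closed. -/
noncomputable def keepOn (I : Set (Edge d)) (ω : Config d) : Config d :=
  fun e => if e ∈ I then ω e else false

theorem SupportedOn.eq_preimage {A : Set (Config d)} {I : Set (Edge d)} (h : SupportedOn A I) :
    A = keepOn I ⁻¹' A := by
  ext ω
  constructor
  · exact fun hω => h (fun e he => by simp [keepOn, he]) hω
  · exact fun hω => h (ω := keepOn I ω) (fun e he => by simp [keepOn, he]) hω

/-- The event is its own preimage under `keepOn I`, a map that reads only the coordinates in `I`. -/
theorem SupportedOn.measurableSet_iSup {A : Set (Config d)} {I : Set (Edge d)}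
    (hA : MeasurableSet A) (h : SupportedOn A I) :
    MeasurableSet[⨆ e ∈ I, MeasurableSpace.comap (fun ω : Config d => ω e) inferInstance] A := by
  rw [h.eq_preimage]
  have : Measurable[⨆ e ∈ I, MeasurableSpace.comap (fun ω : Config d => ω e) inferInstance]
      (keepOn I) := by
    refine @measurable_pi_lambda _ _ _ (_) _ _ fun e => ?_
    by_cases he : e ∈ I
    · simp only [keepOn, he, if_true]
      exact (comap_measurable _).mono (le_iSup₂_of_le e he le_rfl) le_rfl
    · simp only [keepOn, he, if_false]
      exact @measurable_const _ _ _ (_) _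
  exact this hA

theorem perc_real_inter {p : unitInterval} {A B : Set (Config d)} {I J : Set (Edge d)}
    (hA : MeasurableSet A) (hB : MeasurableSet B) (hAI : SupportedOn A I) (hBJ : SupportedOn B J)
    (hIJ : Disjoint I J) :
    (perc d p).real (A ∩ B) = (perc d p).real A * (perc d p).real B := by
  have h : iIndepFun (fun (e : Edge d) (ω : Config d) => ω e) (perc d p) :=
    iIndepFun_infinitePi (X := fun _ b => b) fun _ => measurable_id
  have h2 := indep_iSup_of_disjoint (fun e => (measurable_pi_apply e).comap_le) h hIJ
  have h3 := (Indep_iff _ _ _).1 h2 A B (hAI.measurableSet_iSup hA) (hBJ.measurableSet_iSup hB)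
  simp only [Measure.real, h3, ENNReal.toReal_mul]

/-! ### Monotone coupling -/

theorem measurable_decide_le (p : unitInterval) :
    Measurable fun u : unitInterval => decide (u ≤ p) := by
  refine measurable_to_bool ?_
  have : (fun u : unitInterval => decide (u ≤ p)) ⁻¹' {true} = Iic p := by ext; simp
  rw [this]
  exact measurableSet_Iic

theorem map_decide_volume (p : unitInterval) :
    (volume : Measure unitInterval).map (fun u => decide (u ≤ p)) =
      bernoulliMeasure true false p := by
  have hm : Measurable fun u : unitInterval => decide (u ≤ p) :=
    measurable_decide_le p
  have : IsProbabilityMeasure ((volume : Measure unitInterval).map (fun u => decide (u ≤ p))) :=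
    Measure.isProbabilityMeasure_map hm.aemeasurable
  have h1 : (volume : Measure unitInterval).map (fun u => decide (u ≤ p)) {true} =
      bernoulliMeasure true false p {true} := by
    rw [Measure.map_apply hm (measurableSet_singleton _),
      bernoulliMeasure_apply_of_mem_of_notMem _ (measurableSet_singleton _) (by simp) (by simp)]
    have : (fun u : unitInterval => decide (u ≤ p)) ⁻¹' {true} = Iic p := by ext; simp
    rw [this, unitInterval.volume_Iic, ENNReal.ofReal]
    congr 1
    exact Real.toNNReal_of_nonneg p.2.1
  have h2 : ({false} : Set Bool) = {true}ᶜ := by ext b; cases b <;> simp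
  refine Measure.ext_of_singleton fun b => ?_
  cases b
  · rw [h2, prob_compl_eq_one_sub (measurableSet_singleton _),
      prob_compl_eq_one_sub (measurableSet_singleton _), h1]
  · exact h1

/-- One uniform label per edge realises all parameters at once, with more edges open for larger `p`.
-/
theorem perc_eq_map (p : unitInterval) :
    perc d p = (Measure.infinitePi fun _ : Edge d => (volume : Measure unitInterval)).map
      (fun u e => decide (u e ≤ p)) := by
  rw [Measure.infinitePi_map_pi _ fun _ => measurable_decide_le p]
  simp only [map_decide_volume, perc]

theorem perc_mono {p q : unitInterval} (hpq : p ≤ q) {A : Set (Config d)} (hA : MeasurableSet A)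
    (hup : IsUpperSet A) : perc d p A ≤ perc d q A := by
  have hm : ∀ p : unitInterval, Measurable fun (u : Edge d → unitInterval) e => decide (u e ≤ p) :=
    fun p => measurable_pi_lambda _ fun e =>
      (measurable_decide_le p).comp (measurable_pi_apply e)
  rw [perc_eq_map, perc_eq_map, Measure.map_apply (hm p) hA, Measure.map_apply (hm q) hA]
  refine measure_mono fun u hu => hup (fun e => ?_) hu
  rw [Bool.le_iff_imp]
  simpa using fun h => le_trans h hpq

theorem perc_anti {p q : unitInterval} (hpq : p ≤ q) {A : Set (Config d)} (hA : MeasurableSet A)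
    (hlow : IsLowerSet A) : perc d q A ≤ perc d p A := by
  have h := perc_mono hpq hA.compl hlow.compl
  rw [prob_compl_eq_one_sub hA, prob_compl_eq_one_sub hA] at h
  have h1 := prob_le_one (μ := perc d p) (s := A)
  have h2 := prob_le_one (μ := perc d q) (s := A)
  exact (ENNReal.sub_le_sub_iff_left h2 ENNReal.one_ne_top).1 h

/-! ### Translations and the zero-one law -/

/-- The configuration seen from `v`. -/
def shift (v : Vertex d) (ω : Config d) : Config d := fun e => ω (e.1 + v, e.2)

theorem measurable_shift (v : Vertex d) : Measurable (shift v) :=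
  measurable_pi_lambda _ fun _ => measurable_pi_apply _

theorem measurePreserving_shift (p : unitInterval) (v : Vertex d) :
    MeasurePreserving (shift v) (perc d p) (perc d p) := by
  refine ⟨measurable_shift v, ?_⟩
  -- Reindexing pushes coordinates forward along `σ`, so the translation is by `-v`.
  let σ : Edge d ≃ Edge d := (Equiv.addRight (-v)).prodCongr (Equiv.refl _)
  have h := Measure.infinitePi_map_piCongrLeft
    (fun _ : Edge d => bernoulliMeasure true false p) σ
  have hσ : (MeasurableEquiv.piCongrLeft (fun _ : Edge d => Bool) σ : Config d → Config d) =
      shift v := by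
    funext ω e
    obtain ⟨e', rfl⟩ := σ.surjective e
    rw [MeasurableEquiv.coe_piCongrLeft, Equiv.piCongrLeft_apply_apply]
    simp [shift, σ]
  rw [hσ] at h
  exact h

theorem SupportedOn.shift_preimage {A : Set (Config d)} {I : Set (Edge d)} (h : SupportedOn A I)
    (v : Vertex d) : SupportedOn (shift v ⁻¹' A) ((fun e => (e.1 + v, e.2)) '' I) :=
  fun _ _ hω => h fun e he => hω _ ⟨e, he, rfl⟩

theorem exists_disjoint_translate (hd : 0 < d) (F : Finset (Edge d)) :
    ∃ v : Vertex d, Disjoint (F : Set (Edge d)) ((fun e => (e.1 + v, e.2)) '' (F : Set (Edge d))) := by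
  let i : Fin d := ⟨0, hd⟩
  obtain ⟨M, hM⟩ := (F.image fun e : Edge d => |e.1 i|).bddAbove
  -- A number in `[-M, M]` leaves this interval when `2 * M + 1` is added.
  refine ⟨Pi.single i (2 * M + 1), Set.disjoint_left.2 ?_⟩
  rintro _ he ⟨e, he', rfl⟩
  have h1 : |e.1 i| ≤ M := hM (by
    simp only [Finset.coe_image, mem_image]
    exact ⟨e, he', rfl⟩)
  have h2 : |e.1 i + (2 * M + 1)| ≤ M := hM (by
    simp only [Finset.coe_image, mem_image]
    exact ⟨_, he, by simp⟩)
  rw [abs_le] at h1 h2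
  omega

/-- `A` is approximated by a cylinder `C`, and by invariance equally well by a translate of `C`
depending on disjoint edges. The intersection has probability `P(C)^2` by independence but is also
close to `A`, so `P(A) = P(A)^2`. -/
theorem zero_one_of_shift_invariant (hd : 0 < d) (p : unitInterval) {A : Set (Config d)}
    (hA : MeasurableSet A) (hinv : ∀ v ω, ω ∈ A → shift v ω ∈ A) :
    perc d p A = 0 ∨ perc d p A = 1 := by
  have hinv' : ∀ v, shift v ⁻¹' A = A := by
    intro v
    ext ω
    refine ⟨fun h => ?_, hinv v ω⟩
    have := hinv (-v) _ h
    convert this using 1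
    funext e
    simp [shift]
  set a := (perc d p).real A with ha
  -- With `c = P(C)`, both `|c^2 - a|` and `|c^2 - a^2|` are at most `2 * ε`.
  have key : ∀ ε > 0, |a - a ^ 2| ≤ 4 * ε := by
    intro ε hε
    obtain ⟨C, hC, hCA⟩ := exists_measure_symmDiff_lt_of_generateFrom_isSetRing (μ := perc d p)
      (isSetRing_measurableCylinders (α := fun _ : Edge d => Bool))
      ⟨{univ}, by simp, by simpa using univ_mem_measurableCylinders (fun _ : Edge d => Bool), by simp⟩
      (generateFrom_measurableCylinders (α := fun _ : Edge d => Bool)).symm hA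
      (ENNReal.ofReal_pos.2 hε)
    have hCm := MeasurableSet.of_mem_measurableCylinders hC
    obtain ⟨F, S, -, rfl⟩ := (mem_measurableCylinders _).1 hC
    set C := cylinder (α := fun _ : Edge d => Bool) F S
    have hsupp : SupportedOn C (F : Set (Edge d)) := by
      intro ω ω' h hω
      have : F.restrict ω = F.restrict ω' := funext fun e => h e e.2
      simpa only [C, mem_cylinder, this] using hω
    obtain ⟨v, hv⟩ := exists_disjoint_translate hd F
    have hind := perc_real_inter (p := p) hCm ((measurable_shift v) hCm) hsupp
      (hsupp.shift_preimage v) hv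
    have hmp := measurePreserving_shift p v
    have hpre : ∀ B, MeasurableSet B → (perc d p).real (shift v ⁻¹' B) = (perc d p).real B :=
      fun B hB => by simp only [Measure.real, hmp.measure_preimage hB.nullMeasurableSet]
    rw [hpre C hCm] at hind
    have hlt : (perc d p).real (symmDiff C A) ≤ ε := by
      have := hCA.le
      exact ENNReal.toReal_le_of_le_ofReal hε.le this
    have hlt' : (perc d p).real (symmDiff (shift v ⁻¹' C) A) ≤ ε := by
      have h1 : symmDiff (shift v ⁻¹' C) A = shift v ⁻¹' (symmDiff C A) := by
        conv_lhs => rw [← hinv' v]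
        rfl
      rw [h1, hpre _ (hCm.symmDiff hA)]
      exact hlt
    set c := (perc d p).real C
    have e1 : |c - a| ≤ ε := (abs_measureReal_sub_le_measureReal_symmDiff hCm.nullMeasurableSet
      hA.nullMeasurableSet).trans hlt
    have e2 : |(perc d p).real (C ∩ shift v ⁻¹' C) - a| ≤ 2 * ε := by
      refine (abs_measureReal_sub_le_measureReal_symmDiff
        (hCm.inter (measurable_shift v hCm)).nullMeasurableSet hA.nullMeasurableSet).trans ?_
      have hsub : symmDiff (C ∩ shift v ⁻¹' C) A ⊆
          symmDiff C A ∪ symmDiff (shift v ⁻¹' C) A := by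
        intro ω
        simp only [mem_symmDiff, mem_inter_iff, mem_union]
        tauto
      have := (measureReal_mono (μ := perc d p) hsub).trans (measureReal_union_le _ _)
      linarith
    rw [hind] at e2
    have a0 : 0 ≤ a := measureReal_nonneg
    have a1 : a ≤ 1 := measureReal_le_one
    have c0 : 0 ≤ c := measureReal_nonneg
    have c1 : c ≤ 1 := measureReal_le_one
    rw [abs_le] at *
    constructor <;> nlinarith
  have h0 : a - a ^ 2 = 0 := by
    by_contra hne
    have hpos := abs_pos.2 hne
    have := key (|a - a ^ 2| / 8) (by positivity)
    linarith
  have h1 : a = 0 ∨ a = 1 := by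
    have : a * (1 - a) = 0 := by linarith
    rcases mul_eq_zero.1 this with h | h
    · exact Or.inl h
    · exact Or.inr (by linarith)
  rw [ha, Measure.real] at h1
  rcases h1 with h | h
  · exact Or.inl (((ENNReal.toReal_eq_zero_iff _).1 h).resolve_right (measure_ne_top _ _))
  · exact Or.inr ((ENNReal.toReal_eq_one_iff _).1 h)

/-- Positive probability at some `q > p` passes down to `p` by monotonicity, and the zero-one law
turns it into probability `1`. -/
theorem isThreshold_criticalPoint (hd : 0 < d) {A : Set (Config d)} (hA : MeasurableSet A)
    (hlow : IsLowerSet A) (hinv : ∀ v ω, ω ∈ A → shift v ω ∈ A) :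
    IsThreshold A (criticalPoint A) := by
  have hbdd : BddAbove {p : ℝ | ∃ h : p ∈ unitInterval, 0 < perc d ⟨p, h⟩ A} :=
    ⟨1, fun p hp => hp.1.2⟩
  refine ⟨⟨Real.sSup_nonneg fun p hp => hp.1.1, Real.sSup_le (fun p hp => hp.1.2) zero_le_one⟩,
    fun p => ⟨fun hp => ?_, fun hp => ?_⟩⟩
  · have hne : {p : ℝ | ∃ h : p ∈ unitInterval, 0 < perc d ⟨p, h⟩ A}.Nonempty := by
      by_contra hne
      rw [Set.not_nonempty_iff_eq_empty] at hne
      rw [criticalPoint, hne, Real.sSup_empty] at hp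
      exact absurd p.2.1 (not_le.2 hp)
    obtain ⟨q, ⟨hq, hpos⟩, hpq⟩ := exists_lt_of_lt_csSup hne hp
    have h1 : perc d p A = 1 := (zero_one_of_shift_invariant hd p hA hinv).resolve_left
      (hpos.trans_le (perc_anti (p := p) (q := ⟨q, hq⟩) hpq.le hA hlow)).ne'
    exact (mem_ae_iff_prob_eq_one hA).2 h1
  · rw [ae_iff]
    by_contra hne
    have : {ω | ¬ω ∉ A} = A := by ext; simp
    rw [this] at hne
    exact absurd (le_csSup hbdd ⟨p.2, pos_iff_ne_zero.2 hne⟩) (not_le.2 hp)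

/-! ### Connection events -/

theorem edgeGraph_mono {E E' : Set (Edge d)} (h : E ⊆ E') : edgeGraph E ≤ edgeGraph E' :=
  fun _ _ ⟨e, he, hxy⟩ => ⟨e, h he, hxy⟩

/-- The event that `x` and `y` are joined by a path of open edges of `I`. -/
def linked (I : Set (Edge d)) (x y : Vertex d) : Set (Config d) :=
  {ω | (edgeGraph {e | ω e = true ∧ e ∈ I}).Reachable x y}

theorem mem_linked_univ {ω : Config d} {x y : Vertex d} :
    ω ∈ linked univ x y ↔ (openGraph ω).Reachable x y := by
  simp [linked, openGraph]

theorem supportedOn_linked (I : Set (Edge d)) (x y : Vertex d) : SupportedOn (linked I x y) I := by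
  intro ω ω' h hω
  have : {e | ω e = true ∧ e ∈ I} = {e | ω' e = true ∧ e ∈ I} := by
    ext e
    exact ⟨fun he => ⟨h e he.2 ▸ he.1, he.2⟩, fun he => ⟨(h e he.2).symm ▸ he.1, he.2⟩⟩
  simpa only [linked, mem_ofPred_eq, this] using hω

theorem linked_mono {I J : Set (Edge d)} (h : I ⊆ J) (x y : Vertex d) :
    linked I x y ⊆ linked J x y :=
  fun _ hω => hω.mono (edgeGraph_mono fun _ he => ⟨he.1, h he.2⟩)

theorem isUpperSet_linked (I : Set (Edge d)) (x y : Vertex d) : IsUpperSet (linked I x y) :=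
  fun _ _ hle hω => hω.mono (edgeGraph_mono fun e he =>
    ⟨Bool.le_iff_imp.1 (hle e) he.1, he.2⟩)

theorem exists_finset_reachable {E : Set (Edge d)} {x y : Vertex d}
    (h : (edgeGraph E).Reachable x y) :
    ∃ T : Finset (Edge d), ↑T ⊆ E ∧ (edgeGraph (T : Set (Edge d))).Reachable x y := by
  classical
  obtain ⟨w⟩ := h
  induction w with
  | nil => exact ⟨∅, by simp, SimpleGraph.Reachable.refl _⟩
  | cons hadj _ ih =>
    obtain ⟨T, hT, hr⟩ := ih
    obtain ⟨e, he, h⟩ := hadj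
    refine ⟨insert e T, by simp [insert_subset_iff, he, hT], ?_⟩
    refine SimpleGraph.Reachable.trans (SimpleGraph.Adj.reachable ⟨e, by simp, h⟩)
      (hr.mono (edgeGraph_mono (by simp)))

theorem measurableSet_linked (I : Set (Edge d)) (x y : Vertex d) :
    MeasurableSet (linked I x y) := by
  have : linked I x y = ⋃ T ∈ {T : Finset (Edge d) | ↑T ⊆ I ∧
      (edgeGraph (T : Set (Edge d))).Reachable x y}, ⋂ e ∈ T, (fun ω : Config d => ω e) ⁻¹' {true} := by
    ext ω
    simp only [mem_iUnion, mem_iInter, mem_preimage, mem_singleton_iff, exists_prop]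
    constructor
    · intro h
      obtain ⟨T, hT, hr⟩ := exists_finset_reachable h
      exact ⟨T, ⟨fun e he => (hT he).2, hr⟩, fun e he => (hT he).1⟩
    · rintro ⟨T, ⟨hT, hr⟩, h⟩
      exact hr.mono (edgeGraph_mono fun e he => ⟨h e he, hT he⟩)
  rw [this]
  exact MeasurableSet.biUnion (to_countable _) fun T _ => T.measurableSet_biInter fun e _ =>
    measurable_pi_apply e (measurableSet_singleton _)

/-! ### The event of an infinite component of finite clusters -/

theorem measurableSet_mem_finiteClusters (x : Vertex d) :
    MeasurableSet {ω : Config d | x ∈ finiteClusters ω} := by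
  have : {ω : Config d | x ∈ finiteClusters ω} =
      ⋃ F : Finset (Vertex d), ⋂ y ∈ (F : Set (Vertex d))ᶜ, (linked univ x y)ᶜ := by
    ext ω
    simp only [mem_iUnion, mem_iInter, mem_compl_iff, mem_linked_univ, Finset.mem_coe]
    constructor
    · intro h
      exact ⟨Set.Finite.toFinset h, fun y hy hr => hy ((Set.Finite.mem_toFinset h).2 hr)⟩
    · rintro ⟨F, hF⟩
      exact F.finite_toSet.subset fun y hy => by_contra fun hyF => hF y hyF hy
  rw [this]
  exact MeasurableSet.iUnion fun F => MeasurableSet.biInter (to_countable _) fun y _ =>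
    (measurableSet_linked _ _ _).compl

theorem measurableSet_finiteClustersEvent : MeasurableSet (finiteClustersEvent d) := by
  have hm : ∀ x, Measurable fun ω : Config d => x ∈ finiteClusters ω := fun x =>
    measurableSet_setOfPred.1 (measurableSet_mem_finiteClusters x)
  have : finiteClustersEvent d = {ω | ∃ x, x ∈ finiteClusters ω ∧ ∀ F : Finset (Vertex d),
      x ∈ F → (∀ a : Vertex d, a ∈ F → a ∈ finiteClusters ω) →
        ∃ a, a ∈ F ∧ ∃ b, b ∈ finiteClusters ω ∧ b ∉ F ∧ (lattice d).Adj a b} := by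
    ext ω
    refine hasInfiniteComponent_iff.trans ?_
    exact exists_congr fun x => and_congr_right fun hx => infinite_compOn_iff hx
  rw [this]
  refine measurableSet_setOfPred.2 (Measurable.exists fun x => (hm x).and (Measurable.forall fun F =>
    measurable_const.imp (Measurable.imp (Measurable.forall fun a => measurable_const.imp (hm a))
      (Measurable.exists fun a => measurable_const.and (Measurable.exists fun b =>
        (hm b).and measurable_const)))))

theorem cluster_mono {ω ω' : Config d} (h : ω ≤ ω') (x : Vertex d) :
    cluster ω x ⊆ cluster ω' x :=
  fun _ hy => hy.mono (edgeGraph_mono fun e he => Bool.le_iff_imp.1 (h e) he)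

theorem isLowerSet_finiteClustersEvent : IsLowerSet (finiteClustersEvent d) := by
  intro ω' ω hle hω
  exact HasInfiniteComponent.mono (fun x hx => Set.Finite.subset hx (cluster_mono hle x)) hω

theorem edgeGraph_translate_adj {E : Set (Edge d)} (v : Vertex d) {x y : Vertex d} :
    (edgeGraph {e : Edge d | (e.1 + v, e.2) ∈ E}).Adj x y ↔ (edgeGraph E).Adj (x + v) (y + v) := by
  simp only [edgeGraph_adj, Edge.top]
  constructor
  · rintro ⟨e, he, ⟨rfl, rfl⟩ | ⟨rfl, rfl⟩⟩
    · exact ⟨_, he, Or.inl ⟨rfl, add_right_comm _ _ _⟩⟩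
    · exact ⟨_, he, Or.inr ⟨rfl, add_right_comm _ _ _⟩⟩
  · rintro ⟨⟨z, i⟩, he, h⟩
    have hz : (z - v, i).1 + v = z := sub_add_cancel z v
    refine ⟨(z - v, i), by simpa using he, ?_⟩
    rcases h with ⟨h1, h2⟩ | ⟨h1, h2⟩
    · left
      simp only at h1 h2 ⊢
      subst h1
      exact ⟨by simp, by rw [sub_add_eq_add_sub, h2]; simp⟩
    · right
      simp only at h1 h2 ⊢
      subst h1
      exact ⟨by simp, by rw [sub_add_eq_add_sub, h2]; simp⟩

/-- Translation by `v` as an isomorphism between graphs of edges. -/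
def edgeGraphTranslate (E : Set (Edge d)) (v : Vertex d) :
    edgeGraph {e : Edge d | (e.1 + v, e.2) ∈ E} ≃g edgeGraph E where
  toEquiv := Equiv.addRight v
  map_rel_iff' := (edgeGraph_translate_adj v).symm

theorem shift_mem_linked_univ {ω : Config d} {v x y : Vertex d} :
    shift v ω ∈ linked univ x y ↔ ω ∈ linked univ (x + v) (y + v) := by
  rw [mem_linked_univ, mem_linked_univ]
  exact (edgeGraphTranslate {e | ω e = true} v).reachable_iff.symm

theorem mem_finiteClusters_shift {ω : Config d} {v x : Vertex d} :
    x ∈ finiteClusters (shift v ω) ↔ x + v ∈ finiteClusters ω := by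
  have : cluster (shift v ω) x = (Equiv.addRight v) ⁻¹' (cluster ω (x + v)) := by
    ext y
    have := shift_mem_linked_univ (ω := ω) (v := v) (x := x) (y := y)
    rwa [mem_linked_univ, mem_linked_univ] at this
  simp only [finiteClusters, mem_ofPred_eq, this]
  exact ⟨fun h => h.of_preimage (Equiv.surjective _), fun h =>
    h.preimage (Equiv.injective _).injOn⟩

theorem lattice_adj_add {v x y : Vertex d} :
    (lattice d).Adj (x + v) (y + v) ↔ (lattice d).Adj x y :=
  (edgeGraph_translate_adj (E := univ) v).symm

theorem compOn_image_subset {V V' : Type*} {G : SimpleGraph V} {G' : SimpleGraph V'} (f : V → V')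
    (hf : ∀ a b, G.Adj a b → G'.Adj (f a) (f b)) {U : Set V} {U' : Set V'} (hU : MapsTo f U U')
    (x : V) : f '' compOn G U x ⊆ compOn G' U' (f x) := by
  rintro _ ⟨y, hy, rfl⟩
  induction hy with
  | refl => exact self_mem_compOn _ _
  | tail _ h ih => exact mem_compOn_of_adj ih (hf _ _ h.1) (hU h.2)

theorem shift_mem_finiteClustersEvent (v : Vertex d) (ω : Config d)
    (h : ω ∈ finiteClustersEvent d) : shift v ω ∈ finiteClustersEvent d := by
  obtain ⟨x, hx, hi⟩ := hasInfiniteComponent_iff.1 h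
  have hU : MapsTo (· - v) (finiteClusters ω) (finiteClusters (shift v ω)) := fun y hy => by
    simpa [mem_finiteClusters_shift] using hy
  refine hasInfiniteComponent_iff.2 ⟨x - v, hU hx, ?_⟩
  refine (hi.image (sub_left_injective (b := v)).injOn).mono (compOn_image_subset _ ?_ hU x)
  intro a b hab
  rw [← lattice_adj_add (v := v)]
  simpa using hab

/-! ### The surface event -/

theorem isLowerSet_surfaceEvent : IsLowerSet (surfaceEvent d) := by
  intro ω' ω hle hω
  obtain ⟨E, hE, h⟩ := mem_surfaceEvent_iff.1 hω
  refine mem_surfaceEvent_iff.2 ⟨E, fun e he => ?_, h⟩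
  have h1 := Bool.le_iff_imp.1 (hle e)
  rw [hE e he] at h1
  simpa using h1

theorem mem_squareEdges_translate {x v : Vertex d} {i j : Fin d} {e : Edge d} :
    (e.1 + v, e.2) ∈ squareEdges (x + v) i j ↔ e ∈ squareEdges x i j := by
  obtain ⟨y, k⟩ := e
  simp only [squareEdges, Finset.mem_insert, Finset.mem_singleton, Prod.mk.injEq,
    add_right_comm x v, add_left_inj]

theorem squareGraph_adj_translate {v : Vertex d} {e e' : Edge d} :
    (squareGraph d).Adj (e.1 + v, e.2) (e'.1 + v, e'.2) ↔ (squareGraph d).Adj e e' := by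
  constructor
  · rintro ⟨hne, x, i, j, hij, h, h'⟩
    rw [← sub_add_cancel x v, mem_squareEdges_translate] at h h'
    exact ⟨fun h => hne (h ▸ rfl), _, i, j, hij, h, h'⟩
  · rintro ⟨hne, x, i, j, hij, h, h'⟩
    refine ⟨fun h => hne ?_, x + v, i, j, hij, mem_squareEdges_translate.2 h,
      mem_squareEdges_translate.2 h'⟩
    simp only [Prod.mk.injEq, add_left_inj] at h
    exact Prod.ext h.1 h.2

theorem shift_mem_surfaceEvent (v : Vertex d) (ω : Config d) (h : ω ∈ surfaceEvent d) :
    shift v ω ∈ surfaceEvent d := by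
  obtain ⟨E, hE, hinf, hc, hev⟩ := mem_surfaceEvent_iff.1 h
  let σ : Edge d ≃ Edge d := (Equiv.addRight v).prodCongr (Equiv.refl _)
  refine mem_surfaceEvent_iff.2 ⟨σ ⁻¹' E, fun e he => hE _ he, ?_, ?_, ?_⟩
  · exact hinf.preimage (by simp [σ.surjective.range_eq])
  · have iso : (squareGraph d).induce (σ ⁻¹' E) ≃g (squareGraph d).induce E :=
      { toEquiv := σ.subtypeEquiv fun _ => Iff.rfl
        map_rel_iff' := fun {a b} => squareGraph_adj_translate (v := v) (e := a) (e' := b) }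
    exact iso.connected_iff.2 hc
  · rw [evenOnSquares_iff] at hev ⊢
    intro x i j hij
    have := hev (x + v) i j hij
    simp only [add_right_comm x v] at this
    exact this

/-! ### Measurability of the surface event by compactness -/

theorem finite_squareGraph_neighbours (a : Edge d) : {b | (squareGraph d).Adj a b}.Finite := by
  have : {b | (squareGraph d).Adj a b} ⊆ ⋃ i : Fin d, ⋃ j : Fin d,
      ((squareEdges a.1 i j : Set (Edge d)) ∪ squareEdges (a.1 - Pi.single j 1) i j ∪
        squareEdges (a.1 - Pi.single i 1) i j) := by
    rintro b ⟨-, x, i, j, -, ha, hb⟩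
    simp only [mem_iUnion]
    refine ⟨i, j, ?_⟩
    simp only [squareEdges, Finset.mem_insert, Finset.mem_singleton] at ha
    rcases ha with rfl | rfl | rfl | rfl <;> simp [hb]
  refine Set.Finite.subset ?_ this
  exact Set.finite_iUnion fun i => Set.finite_iUnion fun j =>
    ((Finset.finite_toSet _).union (Finset.finite_toSet _)).union (Finset.finite_toSet _)

/-- Connectedness of `E` is not a closed condition. It is traded for an infinite component at a
marked edge, which is closed because the graph is locally finite; the component inherits parity from
`E`. -/
theorem mem_surfaceEvent_iff_exists_compOn {ω : Config d} : ω ∈ surfaceEvent d ↔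
    ∃ e₀, ∃ E : Set (Edge d), e₀ ∈ E ∧ (∀ e ∈ E, ω e = false) ∧ EvenOnSquares E ∧
      (compOn (squareGraph d) E e₀).Infinite := by
  rw [mem_surfaceEvent_iff]
  constructor
  · rintro ⟨E, hE, hinf, hc, hev⟩
    obtain ⟨e, he⟩ := hinf.nonempty
    exact ⟨e, E, he, hE, hev, by rwa [compOn_eq_of_connected hc he]⟩
  · rintro ⟨e, E, he, hE, hev, hinf⟩
    exact ⟨compOn (squareGraph d) E e, fun a ha => hE a (compOn_subset he ha), hinf,
      induce_compOn_connected he, hev.of_closed (compOn_subset he) fun a ha b hb hab =>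
        mem_compOn_of_adj ha hab hb⟩

/-- For each `e₀`, the admissible pairs of a configuration and a set of edges form a closed set `K
e₀`. The space of sets of edges is compact, so the projection to configurations is closed, and a
countable union over `e₀` remains. -/
theorem measurableSet_surfaceEvent : MeasurableSet (surfaceEvent d) := by
  let K : Edge d → Set (Config d × (Edge d → Bool)) := fun e₀ =>
    {z | z.2 e₀ = true ∧ (∀ e, z.2 e = true → z.1 e = false) ∧
      EvenOnSquares {e | z.2 e = true} ∧
      ∀ F : Finset (Edge d), e₀ ∈ F → (∀ a ∈ F, z.2 a = true) →
        ∃ a ∈ F, ∃ b ∈ {b | (squareGraph d).Adj a b} \ F, z.2 b = true}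
  have hclopen : ∀ (n : ℕ) (c : Fin n → Edge d) (s : Set (Fin n → Bool)),
      IsClosed {z : Config d × (Edge d → Bool) | (fun k => z.2 (c k)) ∈ s} := by
    intro n c s
    exact (isClosed_discrete s).preimage (f := fun z : Config d × (Edge d → Bool) =>
      fun k => z.2 (c k)) (by fun_prop)
  have hbit : ∀ e, IsClosed {z : Config d × (Edge d → Bool) | z.2 e = true} := by
    intro e
    exact (isClosed_discrete {true}).preimage (f := fun z : Config d × (Edge d → Bool) => z.2 e)
      (by fun_prop)
  have hbit' : ∀ e, IsOpen {z : Config d × (Edge d → Bool) | z.2 e = true} := by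
    intro e
    exact (isOpen_discrete {true}).preimage (f := fun z : Config d × (Edge d → Bool) => z.2 e)
      (by fun_prop)
  have hK : ∀ e₀, IsClosed (K e₀) := by
    intro e₀
    refine (hbit e₀).and (IsClosed.and ?_ (IsClosed.and ?_ ?_))
    · simp only [Set.ofPred_forall]
      refine isClosed_iInter fun e => isClosed_imp (hbit' e) ?_
      exact (isClosed_discrete {false}).preimage
        (f := fun z : Config d × (Edge d → Bool) => z.1 e) (by fun_prop)
    · simp only [evenOnSquares_iff, Set.ofPred_forall]
      refine isClosed_iInter fun x => isClosed_iInter fun i => isClosed_iInter fun j =>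
        isClosed_iInter fun _ => ?_
      have := hclopen 4 ![(x, i), (x + Pi.single i 1, j), (x, j), (x + Pi.single j 1, i)]
        {b | (if b 0 = true then (1 : ZMod 2) else 0) + (if b 1 = true then 1 else 0) =
          (if b 2 = true then 1 else 0) + (if b 3 = true then 1 else 0)}
      convert this using 2
      simp only [indicatorTwo, mem_ofPred_eq]
      funext z
      congr!
    · simp only [Set.ofPred_forall]
      refine isClosed_iInter fun F => isClosed_iInter fun _ => isClosed_imp ?_ ?_
      · simp only [Set.ofPred_forall]
        exact F.finite_toSet.isOpen_biInter fun a _ => hbit' a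
      -- A finite set has finitely many neighbours, so this union of closed sets is finite.
      · have : ∀ z : Config d × (Edge d → Bool),
            (∃ a ∈ F, ∃ b ∈ {b | (squareGraph d).Adj a b} \ (F : Set (Edge d)), z.2 b = true) ↔
            z ∈ ⋃ a ∈ (F : Set (Edge d)), ⋃ b ∈ {b | (squareGraph d).Adj a b} \ (F : Set (Edge d)),
              {z : Config d × (Edge d → Bool) | z.2 b = true} := by
          intro z; simp only [mem_iUnion, exists_prop, mem_ofPred_eq, Finset.mem_coe]
        simp only [this]
        exact F.finite_toSet.isClosed_biUnion fun a _ =>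
          ((finite_squareGraph_neighbours a).subset sdiff_subset).isClosed_biUnion fun b _ => hbit b
  have : surfaceEvent d = ⋃ e₀, Prod.fst '' K e₀ := by
    classical
    ext ω
    rw [mem_surfaceEvent_iff_exists_compOn]
    simp only [mem_iUnion]
    refine exists_congr fun e₀ => ?_
    constructor
    · rintro ⟨E, he, hE, hev, hinf⟩
      refine ⟨(ω, fun e => decide (e ∈ E)), ⟨by simpa using he, by simpa using hE, by simpa using hev,
        fun F hF hFE => ?_⟩, rfl⟩
      obtain ⟨a, ha, b, hb, hbF, hab⟩ := (infinite_compOn_iff he).1 hinf F hF (by simpa using hFE)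
      exact ⟨a, ha, b, ⟨hab, hbF⟩, by simpa using hb⟩
    · rintro ⟨⟨ω', z⟩, ⟨he, hE, hev, H⟩, rfl⟩
      refine ⟨{e | z e = true}, he, hE, hev, ?_⟩
      refine (infinite_compOn_iff (U := {e | z e = true}) he).2 fun F hF hFE => ?_
      obtain ⟨a, ha, b, ⟨hab, hbF⟩, hb⟩ := H F hF hFE
      exact ⟨a, ha, b, hb, hbF, hab⟩
  rw [this]
  exact MeasurableSet.iUnion fun e₀ => (isClosedMap_fst_of_compactSpace _ (hK e₀)).measurableSet

/-! ### The two critical points are thresholds -/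

theorem isThreshold_pFin (hd : 0 < d) : IsThreshold (finiteClustersEvent d) (pFin d) :=
  isThreshold_criticalPoint hd measurableSet_finiteClustersEvent isLowerSet_finiteClustersEvent
    shift_mem_finiteClustersEvent

theorem isThreshold_pSurf (hd : 0 < d) : IsThreshold (surfaceEvent d) (pSurf d) :=
  isThreshold_criticalPoint hd measurableSet_surfaceEvent isLowerSet_surfaceEvent
    shift_mem_surfaceEvent

/-! ### Russo's formula -/

/-- The configuration whose open edges are the members of `T`. -/
def openOn (T : Finset (Edge d)) : Config d := fun e => decide (e ∈ T)

/-- The probability that `T` is the set of open edges of `F`. -/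
noncomputable def weight (F T : Finset (Edge d)) (r : ℝ) : ℝ :=
  ∏ e ∈ F, if e ∈ T then r else 1 - r

open Classical in
/-- The probability of `A`, given that all edges outside `F` are closed, as a polynomial. -/
noncomputable def probPoly (F : Finset (Edge d)) (A : Set (Config d)) (r : ℝ) : ℝ :=
  ∑ T ∈ F.powerset, if openOn T ∈ A then weight F T r else 0

theorem perc_real_pi (r : unitInterval) (F T : Finset (Edge d)) :
    (perc d r).real (Set.pi F fun e => {openOn T e}) = weight F T r := by
  rw [Measure.real, perc, Measure.infinitePi_pi _ (fun _ _ => measurableSet_singleton _),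
    ENNReal.toReal_prod]
  refine Finset.prod_congr rfl fun e _ => ?_
  by_cases he : e ∈ T
  · simp only [openOn, he, decide_true, if_true]
    exact bernoulliMeasure_real_apply_of_mem_of_notMem _ (measurableSet_singleton _) (by simp)
      (by simp)
  · simp only [openOn, he, decide_false, if_false]
    exact bernoulliMeasure_real_apply_of_notMem_of_mem _ (measurableSet_singleton _) (by simp)
      (by simp)

theorem perc_real_eq_probPoly {F : Finset (Edge d)} {A : Set (Config d)}
    (hA : SupportedOn A (F : Set (Edge d))) (r : unitInterval) :
    (perc d r).real A = probPoly F A r := by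
  classical
  have hU : A = ⋃ T ∈ F.powerset.filter (fun T => openOn T ∈ A),
      Set.pi F fun e => {openOn T e} := by
    ext ω
    simp only [mem_iUnion, exists_prop, Finset.mem_filter, Finset.mem_powerset, Set.mem_pi,
      mem_singleton_iff]
    constructor
    · intro hω
      have h : ∀ e ∈ (F : Set (Edge d)), ω e = openOn (F.filter fun e => ω e = true) e := by
        intro e he
        have he' : e ∈ F := he
        simp [openOn, he']
      exact ⟨F.filter fun e => ω e = true, ⟨Finset.filter_subset _ _, hA h hω⟩, h⟩
    · rintro ⟨T, ⟨-, hT⟩, h⟩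
      exact hA (fun e he => (h e he).symm) hT
  conv_lhs => rw [hU]
  rw [measureReal_biUnion_finset, probPoly, Finset.sum_filter]
  · exact Finset.sum_congr rfl fun T _ => by rw [perc_real_pi]
  · intro T hT T' hT' hne
    refine Set.disjoint_left.2 fun ω h h' => hne ?_
    simp only [Finset.coe_filter, Finset.mem_powerset, mem_ofPred_eq] at hT hT'
    ext e
    by_cases he : e ∈ F
    · have h1 := h e he
      have h2 := h' e he
      simp only [mem_singleton_iff] at h1 h2
      rw [h1] at h2
      simpa [openOn] using h2
    · exact ⟨fun h => absurd (hT.1 h) he, fun h => absurd (hT'.1 h) he⟩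
  · exact fun T _ => MeasurableSet.pi (Finset.countable_toSet _) fun _ _ =>
      measurableSet_singleton _

/-- The event that the edge `e` is pivotal for `A`. -/
def pivotal (A : Set (Config d)) (e : Edge d) : Set (Config d) :=
  {ω | Function.update ω e true ∈ A ∧ Function.update ω e false ∉ A}

theorem supportedOn_pivotal {A : Set (Config d)} {F : Finset (Edge d)}
    (hA : SupportedOn A (F : Set (Edge d))) (e : Edge d) :
    SupportedOn (pivotal A e) (F.erase e : Finset (Edge d)) := by
  intro ω ω' h hω
  have key : ∀ b, ∀ e' ∈ (F : Set (Edge d)),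
      Function.update ω e b e' = Function.update ω' e b e' := by
    intro b e' he'
    by_cases hee : e' = e
    · subst hee; simp
    · simpa [hee] using h e' (by simpa [hee] using he')
  simp only [pivotal, mem_ofPred_eq] at hω ⊢
  refine ⟨hA (fun e' he' => ?_) hω.1, fun hn => hω.2 (hA (fun e' he' => ?_) hn)⟩
  · exact key true e' he'
  · exact (key false e' he').symm

/-- Russo's formula, as an identity of polynomials. In the derivative with respect to the edge `e`,
the configurations with `e` open and with `e` closed have opposite signs and the same weight on the
other edges. For increasing `A` they cancel unless `e` is pivotal. -/
theorem hasDerivAt_probPoly {F : Finset (Edge d)} {A : Set (Config d)}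
    (hup : IsUpperSet A) (r : ℝ) :
    HasDerivAt (probPoly F A) (∑ e ∈ F, probPoly (F.erase e) (pivotal A e) r) r := by
  classical
  have hw : ∀ T : Finset (Edge d), HasDerivAt (weight F T)
      (∑ e ∈ F, weight (F.erase e) T r * (if e ∈ T then 1 else -1)) r := by
    intro T
    have h1 : ∀ e ∈ F, HasDerivAt (fun s : ℝ => if e ∈ T then s else 1 - s)
        (if e ∈ T then 1 else -1) r := by
      intro e _
      by_cases he : e ∈ T
      · simp only [he, if_true]
        exact hasDerivAt_id r
      · simp only [he, if_false]
        exact (hasDerivAt_id r).const_sub 1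
    exact HasDerivAt.fun_finsetProd h1
  have hsum : HasDerivAt (probPoly F A) (∑ T ∈ F.powerset, if openOn T ∈ A then
      (∑ e ∈ F, weight (F.erase e) T r * (if e ∈ T then 1 else -1)) else 0) r := by
    unfold probPoly
    refine HasDerivAt.fun_sum fun T _ => ?_
    by_cases hT : openOn T ∈ A
    · simpa [hT] using hw T
    · simpa [hT] using hasDerivAt_const r (0 : ℝ)
  convert hsum using 1
  have : ∀ T : Finset (Edge d), (if openOn T ∈ A then
      (∑ e ∈ F, weight (F.erase e) T r * (if e ∈ T then (1 : ℝ) else -1)) else 0) =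
      ∑ e ∈ F, (if openOn T ∈ A then weight (F.erase e) T r * (if e ∈ T then 1 else -1) else 0) := by
    intro T
    split_ifs <;> simp
  simp only [this]
  rw [Finset.sum_comm]
  refine Finset.sum_congr rfl fun e he => ?_
  conv_rhs => rw [← Finset.insert_erase he]
  -- The configurations are paired as `T` and `insert e T`, with `e ∉ T`.
  rw [Finset.sum_powerset_insert (Finset.notMem_erase e F), ← Finset.sum_add_distrib, probPoly]
  refine Finset.sum_congr rfl fun T hT => ?_
  have heT : e ∉ T := fun h => Finset.notMem_erase e F (Finset.mem_powerset.1 hT h)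
  have h1 : weight (F.erase e) (insert e T) r = weight (F.erase e) T r := by
    refine Finset.prod_congr rfl fun e' he' => ?_
    have : e' ≠ e := (Finset.mem_erase.1 he').1
    simp [this]
  have h2 : openOn T ∈ A → openOn (insert e T) ∈ A := by
    intro h
    refine hup (fun e' => ?_) h
    rw [Bool.le_iff_imp]
    simp only [openOn, decide_eq_true_eq]
    exact fun h => Finset.mem_insert_of_mem h
  have h3 : openOn T ∈ pivotal A e ↔ openOn (insert e T) ∈ A ∧ openOn T ∉ A := by
    have e1 : Function.update (openOn T) e true = openOn (insert e T) := by
      funext e'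
      by_cases h : e' = e
      · subst h; simp [openOn]
      · simp [openOn, h]
    have e2 : Function.update (openOn T) e false = openOn T := by
      funext e'
      by_cases h : e' = e
      · subst h; simp [openOn, heT]
      · simp [h]
    simp only [pivotal, mem_ofPred_eq]
    rw [e1, e2]
  rw [Finset.insert_erase he, h1]
  simp only [heT, if_false, Finset.mem_insert_self, if_true, h3]
  by_cases a : openOn T ∈ A
  · simp [a, h2 a]
  · by_cases b : openOn (insert e T) ∈ A <;> simp [a, b]

/-! ### Exploration from outside a finite set -/

/-- The edges with at least one end in `Λ`. -/
def edgesAt (Λ : Finset (Vertex d)) : Finset (Edge d) :=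
  (Λ ×ˢ Finset.univ) ∪ (Λ ×ˢ Finset.univ).image fun e => (e.1 - Pi.single e.2 1, e.2)

theorem mem_edgesAt {Λ : Finset (Vertex d)} {e : Edge d} :
    e ∈ edgesAt Λ ↔ e.1 ∈ Λ ∨ e.top ∈ Λ := by
  simp only [edgesAt, Finset.mem_union, Finset.mem_product, Finset.mem_univ, and_true,
    Finset.mem_image, Edge.top]
  refine or_congr_right ⟨?_, fun h => ⟨(e.1 + Pi.single e.2 1, e.2), h, ?_⟩⟩
  · rintro ⟨e', h, rfl⟩
    simpa using h
  · simp

/-- The edges with both ends in `S`. -/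
def inside (S : Set (Vertex d)) : Set (Edge d) := {e | e.1 ∈ S ∧ e.top ∈ S}

open Classical in
/-- The edges with exactly one end in the finite set `S`. -/
noncomputable def cutFinset (S : Finset (Vertex d)) : Finset (Edge d) :=
  (edgesAt S).filter (· ∈ cut (S : Set (Vertex d)))

theorem mem_cutFinset {S : Finset (Vertex d)} {e : Edge d} :
    e ∈ cutFinset S ↔ e ∈ cut (S : Set (Vertex d)) := by
  simp only [cutFinset, Finset.mem_filter, mem_edgesAt, and_iff_right_iff_imp, cut, mem_ofPred_eq,
    Finset.mem_coe]
  tauto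

/-- The event that some end of `e` in `S` is joined to the origin inside `S`. -/
def linkedInside (S : Finset (Vertex d)) (e : Edge d) : Set (Config d) :=
  ⋃ v ∈ {v : Vertex d | v ∈ S ∧ (v = e.1 ∨ v = e.top)}, linked (inside (S : Set (Vertex d))) 0 v

theorem measurableSet_linkedInside (S : Finset (Vertex d)) (e : Edge d) :
    MeasurableSet (linkedInside S e) :=
  MeasurableSet.biUnion (to_countable _) fun _ _ => measurableSet_linked _ _ _

theorem SupportedOn.biUnion {ι : Type*} {s : Set ι} {A : ι → Set (Config d)} {I : Set (Edge d)}
    (h : ∀ i ∈ s, SupportedOn (A i) I) : SupportedOn (⋃ i ∈ s, A i) I := by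
  intro ω ω' hω hA
  simp only [mem_iUnion] at hA ⊢
  obtain ⟨i, hi, hA⟩ := hA
  exact ⟨i, hi, h i hi hω hA⟩

theorem SupportedOn.biInter {ι : Type*} {s : Set ι} {A : ι → Set (Config d)} {I : Set (Edge d)}
    (h : ∀ i ∈ s, SupportedOn (A i) I) : SupportedOn (⋂ i ∈ s, A i) I := by
  intro ω ω' hω hA
  simp only [mem_iInter] at hA ⊢
  exact fun i hi => h i hi hω (hA i hi)

theorem SupportedOn.inter {A B : Set (Config d)} {I : Set (Edge d)}
    (hA : SupportedOn A I) (hB : SupportedOn B I) : SupportedOn (A ∩ B) I :=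
  fun _ _ hω h => ⟨hA hω h.1, hB hω h.2⟩

theorem SupportedOn.mono {A : Set (Config d)} {I J : Set (Edge d)} (hA : SupportedOn A I)
    (hIJ : I ⊆ J) : SupportedOn A J := fun _ _ hω h => hA (fun e he => hω e (hIJ he)) h

theorem isUpperSet_linkedInside (S : Finset (Vertex d)) (e : Edge d) :
    IsUpperSet (linkedInside S e) :=
  isUpperSet_iUnion₂ fun _ _ => isUpperSet_linked _ _ _

theorem supportedOn_linkedInside (S : Finset (Vertex d)) (e : Edge d) :
    SupportedOn (linkedInside S e) (inside (S : Set (Vertex d))) :=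
  SupportedOn.biUnion fun _ _ => supportedOn_linked _ _ _

/-- The expected number, divided by the edge density, of open edges of the boundary of `S` that are
joined to the origin inside `S`. -/
noncomputable def boundarySum (p : unitInterval) (S : Finset (Vertex d)) : ℝ :=
  ∑ e ∈ cutFinset S, (perc d p).real (linkedInside S e)

theorem boundarySum_mono {p q : unitInterval} (h : p ≤ q) (S : Finset (Vertex d)) :
    boundarySum p S ≤ boundarySum q S :=
  Finset.sum_le_sum fun e _ => ENNReal.toReal_mono (measure_ne_top _ _)
    (perc_mono h (measurableSet_linkedInside S e) (isUpperSet_linkedInside S e))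

/-- The event that `x` is joined by open edges of `I` to a vertex outside `Λ`. -/
def escape (Λ : Finset (Vertex d)) (I : Set (Edge d)) (x : Vertex d) : Set (Config d) :=
  ⋃ y ∈ {y : Vertex d | y ∉ Λ}, linked I x y

theorem measurableSet_escape (Λ : Finset (Vertex d)) (I : Set (Edge d)) (x : Vertex d) :
    MeasurableSet (escape Λ I x) :=
  MeasurableSet.biUnion (to_countable _) fun _ _ => measurableSet_linked _ _ _

theorem isUpperSet_escape (Λ : Finset (Vertex d)) (I : Set (Edge d)) (x : Vertex d) :
    IsUpperSet (escape Λ I x) :=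
  isUpperSet_iUnion₂ fun _ _ => isUpperSet_linked _ _ _

theorem supportedOn_escape (Λ : Finset (Vertex d)) (I : Set (Edge d)) (x : Vertex d) :
    SupportedOn (escape Λ I x) I :=
  SupportedOn.biUnion fun _ _ => supportedOn_linked _ _ _

theorem mem_escape {Λ : Finset (Vertex d)} {I : Set (Edge d)} {x : Vertex d} {ω : Config d} :
    ω ∈ escape Λ I x ↔ ∃ y ∉ Λ, ω ∈ linked I x y := by
  simp only [escape, mem_iUnion, exists_prop, mem_ofPred_eq]

theorem escape_mono {Λ : Finset (Vertex d)} {I J : Set (Edge d)} (h : I ⊆ J) (x : Vertex d) :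
    escape Λ I x ⊆ escape Λ J x := by
  intro ω
  simp only [mem_escape]
  exact fun ⟨y, hy, hω⟩ => ⟨y, hy, linked_mono h _ _ hω⟩

theorem linked_trans {I : Set (Edge d)} {x y z : Vertex d} {ω : Config d}
    (h : ω ∈ linked I x y) (h' : ω ∈ linked I y z) : ω ∈ linked I x z :=
  SimpleGraph.Reachable.trans h h'

theorem linked_symm {I : Set (Edge d)} {x y : Vertex d} {ω : Config d}
    (h : ω ∈ linked I x y) : ω ∈ linked I y x :=
  SimpleGraph.Reachable.symm h

theorem linked_refl (I : Set (Edge d)) (x : Vertex d) (ω : Config d) : ω ∈ linked I x x :=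
  SimpleGraph.Reachable.refl _

theorem linked_edge {I : Set (Edge d)} {e : Edge d} {ω : Config d} (he : e ∈ I)
    (hω : ω e = true) : ω ∈ linked I e.1 e.top :=
  SimpleGraph.Adj.reachable (edgeGraph_adj.2 ⟨e, ⟨hω, he⟩, Or.inl ⟨rfl, rfl⟩⟩)

theorem escape_of_linked {Λ : Finset (Vertex d)} {I : Set (Edge d)} {x y : Vertex d}
    {ω : Config d} (h : ω ∈ linked I x y) (h' : ω ∈ escape Λ I y) : ω ∈ escape Λ I x := by
  rw [mem_escape] at *
  obtain ⟨z, hz, hyz⟩ := h'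
  exact ⟨z, hz, linked_trans h hyz⟩

/-- The event that `S` is the set of vertices of `Λ` that are not joined to its outside, expressed
in terms of edges that do not lie inside `S`. -/
def enclosed (Λ S : Finset (Vertex d)) : Set (Config d) :=
  (⋂ e ∈ cut (S : Set (Vertex d)), (fun ω : Config d => ω e) ⁻¹' {false}) ∩
    ⋂ x ∈ {x : Vertex d | x ∉ S}, escape Λ (edgesAt Λ ∩ inside (S : Set (Vertex d))ᶜ) x

theorem measurableSet_enclosed (Λ S : Finset (Vertex d)) : MeasurableSet (enclosed Λ S) :=
  (MeasurableSet.biInter (to_countable _) fun _ _ =>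
    measurable_pi_apply _ (measurableSet_singleton _)).inter
  (MeasurableSet.biInter (to_countable _) fun _ _ => measurableSet_escape _ _ _)

theorem supportedOn_enclosed (Λ S : Finset (Vertex d)) :
    SupportedOn (enclosed Λ S) (inside (S : Set (Vertex d)))ᶜ := by
  refine SupportedOn.inter (SupportedOn.biInter fun e he => ?_) (SupportedOn.biInter fun x _ =>
    (supportedOn_escape _ _ _).mono ?_)
  · intro ω ω' h hω
    have : e ∈ (inside (S : Set (Vertex d)))ᶜ := fun hin => he ⟨fun _ => hin.2, fun _ => hin.1⟩
    simpa [h e this] using hω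
  · exact fun e he hin => he.2.1 hin.1

theorem mem_enclosed {Λ S : Finset (Vertex d)} {ω : Config d} : ω ∈ enclosed Λ S ↔
    (∀ e ∈ cut (S : Set (Vertex d)), ω e = false) ∧
      ∀ x ∉ S, ω ∈ escape Λ (edgesAt Λ ∩ inside (S : Set (Vertex d))ᶜ) x := by
  simp only [enclosed, mem_inter_iff, mem_iInter, mem_preimage, mem_singleton_iff, mem_ofPred_eq]

theorem exists_cut_edge_of_reachable {E : Set (Edge d)} {S : Set (Vertex d)} {x y : Vertex d}
    (h : (edgeGraph E).Reachable x y) (hx : x ∈ S) (hy : y ∉ S) : ∃ e ∈ E, e ∈ cut S := by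
  obtain ⟨w⟩ := h
  induction w with
  | nil => exact absurd hx hy
  | @cons u v w hadj _ ih =>
    by_cases hv : v ∈ S
    · exact ih hv hy
    · obtain ⟨e, he, ⟨rfl, rfl⟩ | ⟨rfl, rfl⟩⟩ := edgeGraph_adj.1 hadj
      · exact ⟨e, he, fun h => hv (h.1 hx)⟩
      · exact ⟨e, he, fun h => hv (h.2 hx)⟩

/-- The closed cut keeps `S` from escaping, and all other vertices escape. So `ω` determines `S`,
and the events for different `S` are disjoint. -/
theorem mem_iff_notMem_escape_of_enclosed {Λ S : Finset (Vertex d)} {ω : Config d} (hS : S ⊆ Λ)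
    (h : ω ∈ enclosed Λ S) (x : Vertex d) : x ∈ S ↔ ω ∉ escape Λ (edgesAt Λ) x := by
  rw [mem_enclosed] at h
  constructor
  · intro hx hesc
    obtain ⟨y, hy, hxy⟩ := mem_escape.1 hesc
    obtain ⟨e, he, hec⟩ := exists_cut_edge_of_reachable (S := (S : Set (Vertex d))) hxy hx
      fun hyS => hy (hS hyS)
    have h1 := h.1 e hec
    rw [he.1] at h1
    exact absurd h1 (by simp)
  · intro hesc
    by_contra hx
    exact hesc (escape_mono inter_subset_left _ (h.2 x hx))

/-- `S` is the set of vertices that do not escape. An open edge of its cut would let its inner end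
escape too, and an escaping path never visits `S`. -/
theorem exists_enclosed_of_notMem_escape {Λ : Finset (Vertex d)} {ω : Config d} {x : Vertex d}
    (h : ω ∉ escape Λ (edgesAt Λ) x) : ∃ S ⊆ Λ, x ∈ S ∧ ω ∈ enclosed Λ S := by
  classical
  have hout : ∀ y ∉ Λ, ω ∈ escape Λ (edgesAt Λ) y := fun y hy =>
    mem_escape.2 ⟨y, hy, linked_refl _ _ _⟩
  let S := Λ.filter fun y => ω ∉ escape Λ (edgesAt Λ) y
  have hS : ∀ y, y ∈ S ↔ ω ∉ escape Λ (edgesAt Λ) y := by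
    intro y
    simp only [S, Finset.mem_filter, and_iff_right_iff_imp]
    exact fun hy => by_contra fun hyΛ => hy (hout y hyΛ)
  refine ⟨S, Finset.filter_subset _ _, (hS x).2 h, mem_enclosed.2 ⟨fun e he => ?_, fun y hy => ?_⟩⟩
  · by_contra hω
    have hω' : ω e = true := by simpa using hω
    apply he
    simp only [Finset.mem_coe, hS, not_iff_not]
    have heF : e ∈ (edgesAt Λ : Set (Edge d)) := by
      by_contra heF
      rw [Finset.mem_coe, mem_edgesAt, not_or] at heF
      apply he
      simp only [Finset.mem_coe, hS, hout _ heF.1, hout _ heF.2]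
    exact ⟨escape_of_linked (linked_symm (linked_edge heF hω')),
      escape_of_linked (linked_edge heF hω')⟩
  · rw [hS, not_not, mem_escape] at hy
    obtain ⟨z, hz, hr⟩ := hy
    refine mem_escape.2 ⟨z, hz, ?_⟩
    obtain ⟨w⟩ := hr
    induction w with
    | nil => exact linked_refl _ _ _
    | @cons u v z hadj w ih =>
      have hv : v ∉ S := by
        rw [hS, not_not]
        exact mem_escape.2 ⟨z, hz, ⟨w⟩⟩
      have hu : u ∉ S := by
        rw [hS, not_not]
        exact mem_escape.2 ⟨z, hz, ⟨SimpleGraph.Walk.cons hadj w⟩⟩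
      refine linked_trans ?_ (ih hz)
      obtain ⟨e, he, h⟩ := edgeGraph_adj.1 hadj
      refine SimpleGraph.Adj.reachable (edgeGraph_adj.2 ⟨e, ⟨he.1, he.2, ?_⟩, h⟩)
      rcases h with ⟨rfl, rfl⟩ | ⟨rfl, rfl⟩
      · exact ⟨hu, hv⟩
      · exact ⟨hv, hu⟩

/-- With `e` closed the origin is confined to `S`. Opening `e` joins it to the other end of `e`,
which lies outside `S` and therefore escapes. -/
theorem pivotal_of_enclosed {Λ S : Finset (Vertex d)} {ω : Config d} (hS : S ⊆ Λ) (h0 : 0 ∈ S)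
    {e : Edge d} (he : e ∈ cut (S : Set (Vertex d))) (h : ω ∈ enclosed Λ S)
    (hl : ω ∈ linkedInside S e) : ω ∈ pivotal (escape Λ (edgesAt Λ) 0) e := by
  have hfalse : ω e = false := (mem_enclosed.1 h).1 e he
  constructor
  · have hle : ω ≤ Function.update ω e true := by
      intro e'
      by_cases hee : e' = e
      · subst hee; simp
      · simp [hee]
    simp only [linkedInside, mem_iUnion, exists_prop] at hl
    obtain ⟨v, ⟨hvS, hv⟩, hl⟩ := hl
    have heF : e ∈ (edgesAt Λ : Set (Edge d)) := by
      rw [Finset.mem_coe, mem_edgesAt]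
      rcases hv with rfl | rfl
      · exact Or.inl (hS hvS)
      · exact Or.inr (hS hvS)
    have h1 : Function.update ω e true ∈ linked (edgesAt Λ) 0 v := by
      refine isUpperSet_linked _ _ _ hle (linked_mono (fun e' he' => ?_) _ _ hl)
      rw [Finset.mem_coe, mem_edgesAt]
      exact Or.inl (hS he'.1)
    have h2 : Function.update ω e true ∈ linked (edgesAt Λ) e.1 e.top :=
      linked_edge heF (by simp)
    have h3 : ∀ y ∉ S, Function.update ω e true ∈ escape Λ (edgesAt Λ) y := fun y hy =>
      isUpperSet_escape _ _ _ hle (escape_mono inter_subset_left _ ((mem_enclosed.1 h).2 y hy))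
    simp only [cut, mem_ofPred_eq, Finset.mem_coe] at he
    rcases hv with rfl | rfl
    · exact escape_of_linked (linked_trans h1 h2) (h3 _ fun ht => he ⟨fun _ => ht, fun _ => hvS⟩)
    · exact escape_of_linked (linked_trans h1 (linked_symm h2))
        (h3 _ fun ht => he ⟨fun _ => hvS, fun _ => ht⟩)
  · rw [← hfalse, Function.update_eq_self]
    exact (mem_iff_notMem_escape_of_enclosed hS h 0).1 h0

/-- The event of no escape is split according to the set `S` of confined vertices. Since `enclosed Λ
S` is independent of the edges inside `S`, the hypothesis bounds its probability by a sum over the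
edges of the cut, each term of which is carried by pivotality of that edge. -/
theorem one_sub_le_sum_pivotal {Λ : Finset (Vertex d)} (r : unitInterval)
    (h : ∀ S : Finset (Vertex d), 0 ∈ S → 1 ≤ boundarySum r S) :
    1 - (perc d r).real (escape Λ (edgesAt Λ) 0) ≤
      ∑ e ∈ edgesAt Λ, (perc d r).real (pivotal (escape Λ (edgesAt Λ) 0) e) := by
  classical
  set A := escape Λ (edgesAt Λ) 0 with hA
  have hAm : MeasurableSet A := measurableSet_escape _ _ _
  let 𝒮 := Λ.powerset.filter fun S => (0 : Vertex d) ∈ S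
  have h𝒮 : ∀ S ∈ 𝒮, S ⊆ Λ ∧ 0 ∈ S := fun S hS => by simpa [𝒮] using hS
  have h1 : 1 - (perc d r).real A ≤ ∑ S ∈ 𝒮, (perc d r).real (enclosed Λ S) := by
    rw [← probReal_compl_eq_one_sub hAm]
    refine (measureReal_mono ?_ (measure_ne_top _ _)).trans (measureReal_biUnion_finset_le _ _)
    intro ω hω
    obtain ⟨S, hS, h0, hω⟩ := exists_enclosed_of_notMem_escape hω
    simp only [mem_iUnion]
    exact ⟨S, by simp [𝒮, hS, h0], hω⟩
  have h2 : ∀ S ∈ 𝒮, (perc d r).real (enclosed Λ S) ≤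
      ∑ e ∈ cutFinset S, (perc d r).real (enclosed Λ S ∩ linkedInside S e) := by
    intro S hS
    have hind : ∀ e, (perc d r).real (enclosed Λ S ∩ linkedInside S e) =
        (perc d r).real (enclosed Λ S) * (perc d r).real (linkedInside S e) := fun e =>
      perc_real_inter (measurableSet_enclosed _ _) (measurableSet_linkedInside _ _)
        (supportedOn_enclosed _ _) (supportedOn_linkedInside _ _) disjoint_compl_left
    simp only [hind]
    rw [← Finset.mul_sum]
    exact le_mul_of_one_le_right measureReal_nonneg (h S (h𝒮 S hS).2)
  have h3 : ∀ S ∈ 𝒮, cutFinset S ⊆ edgesAt Λ := by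
    intro S hS e he
    have := (Finset.mem_filter.1 he).1
    rw [mem_edgesAt] at this ⊢
    exact this.imp (fun h => (h𝒮 S hS).1 h) fun h => (h𝒮 S hS).1 h
  calc 1 - (perc d r).real A
      ≤ ∑ S ∈ 𝒮, ∑ e ∈ cutFinset S, (perc d r).real (enclosed Λ S ∩ linkedInside S e) :=
        h1.trans (Finset.sum_le_sum h2)
    _ = ∑ S ∈ 𝒮, ∑ e ∈ edgesAt Λ, if e ∈ cutFinset S then
          (perc d r).real (enclosed Λ S ∩ linkedInside S e) else 0 := by
        refine Finset.sum_congr rfl fun S hS => ?_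
        rw [← Finset.sum_filter, Finset.filter_mem_eq_inter, Finset.inter_eq_right.2 (h3 S hS)]
    _ = ∑ e ∈ edgesAt Λ, ∑ S ∈ 𝒮, if e ∈ cutFinset S then
          (perc d r).real (enclosed Λ S ∩ linkedInside S e) else 0 := Finset.sum_comm
    _ ≤ ∑ e ∈ edgesAt Λ, (perc d r).real (pivotal A e) := by
        refine Finset.sum_le_sum fun e _ => ?_
        rw [← Finset.sum_filter, ← measureReal_biUnion_finset]
        · refine measureReal_mono ?_ (measure_ne_top _ _)
          intro ω hω
          simp only [mem_iUnion, Finset.mem_filter] at hω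
          obtain ⟨S, ⟨hS, he⟩, hω⟩ := hω
          exact pivotal_of_enclosed (h𝒮 S hS).1 (h𝒮 S hS).2 (mem_cutFinset.1 he) hω.1 hω.2
        · intro S hS S' hS' hne
          refine Set.disjoint_left.2 fun ω hω hω' => hne ?_
          have hS := h𝒮 S (Finset.mem_filter.1 hS).1
          have hS' := h𝒮 S' (Finset.mem_filter.1 hS').1
          ext x
          rw [mem_iff_notMem_escape_of_enclosed hS.1 hω.1,
            mem_iff_notMem_escape_of_enclosed hS'.1 hω'.1]
        · exact fun S _ => (measurableSet_enclosed _ _).inter (measurableSet_linkedInside _ _)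

/-! ### Sharpness -/

/-- By Russo's formula, the derivative of the escape probability on `(q, p)` is at least one minus
that probability, which is smallest at `p`. The mean value theorem then suffices. -/
theorem le_perc_escape {Λ : Finset (Vertex d)} {q p : unitInterval} (hqp : q < p)
    (h : ∀ S : Finset (Vertex d), 0 ∈ S → 1 ≤ boundarySum q S) :
    (1 - (perc d p).real (escape Λ (edgesAt Λ) 0)) * ((p : ℝ) - q) ≤
      (perc d p).real (escape Λ (edgesAt Λ) 0) := by
  set A := escape Λ (edgesAt Λ) 0 with hA
  have hAm : MeasurableSet A := measurableSet_escape _ _ _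
  have hup : IsUpperSet A := isUpperSet_escape _ _ _
  have hsupp : SupportedOn A (edgesAt Λ : Set (Edge d)) := supportedOn_escape _ _ _
  have hderiv : ∀ r, HasDerivAt (probPoly (edgesAt Λ) A) _ r := fun r => hasDerivAt_probPoly hup r
  obtain ⟨c, hc, hslope⟩ := exists_hasDerivAt_eq_slope (probPoly (edgesAt Λ) A) _
    (show (q : ℝ) < p from hqp) (fun x _ => (hderiv x).continuousAt.continuousWithinAt)
    fun x _ => hderiv x
  have hcI : c ∈ unitInterval := ⟨q.2.1.trans hc.1.le, hc.2.le.trans p.2.2⟩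
  let r : unitInterval := ⟨c, hcI⟩
  -- The hypothesis at `q` persists at `c > q`, because `linkedInside` is increasing.
  have h1 := one_sub_le_sum_pivotal (Λ := Λ) r fun S hS =>
    (h S hS).trans (boundarySum_mono (show q ≤ r from hc.1.le) S)
  have h2 : (perc d r).real A ≤ (perc d p).real A :=
    ENNReal.toReal_mono (measure_ne_top _ _) (perc_mono (show r ≤ p from hc.2.le) hAm hup)
  have h3 : ∀ e, (perc d r).real (pivotal A e) = probPoly ((edgesAt Λ).erase e) (pivotal A e) c :=
    fun e => perc_real_eq_probPoly (supportedOn_pivotal hsupp e) r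
  rw [← hA] at h1
  have h7 : (0 : ℝ) < p - q := sub_pos.2 (show (q : ℝ) < p from hqp)
  simp only [h3, hslope] at h1
  rw [le_div_iff₀ h7] at h1
  have h4 : probPoly (edgesAt Λ) A p = (perc d p).real A := (perc_real_eq_probPoly hsupp p).symm
  have h5 : probPoly (edgesAt Λ) A q = (perc d q).real A := (perc_real_eq_probPoly hsupp q).symm
  rw [h4, h5] at h1
  have h6 : 0 ≤ (perc d q).real A := measureReal_nonneg
  nlinarith

/-- The box of radius `n` about the origin. -/
noncomputable def box (d n : ℕ) : Finset (Vertex d) := Finset.Icc (fun _ => -(n : ℤ)) fun _ => (n : ℤ)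

theorem mem_box {n : ℕ} {x : Vertex d} : x ∈ box d n ↔ ∀ i, |x i| ≤ n := by
  simp only [box, Finset.mem_Icc, Pi.le_def, abs_le, forall_and]

theorem box_mono {m n : ℕ} (h : m ≤ n) : box d m ⊆ box d n := by
  intro x hx
  rw [mem_box] at *
  exact fun i => (hx i).trans (by exact_mod_cast h)

theorem exists_subset_box (S : Finset (Vertex d)) : ∃ n, S ⊆ box d n := by
  refine ⟨∑ x ∈ S, ∑ i, (x i).natAbs, fun x hx => mem_box.2 fun i => ?_⟩
  have h1 : (x i).natAbs ≤ ∑ i, (x i).natAbs :=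
    Finset.single_le_sum (f := fun i => (x i).natAbs) (fun _ _ => Nat.zero_le _) (Finset.mem_univ i)
  have h2 : ∑ i, (x i).natAbs ≤ ∑ x ∈ S, ∑ i, (x i).natAbs :=
    Finset.single_le_sum (f := fun x : Vertex d => ∑ i, (x i).natAbs)
      (fun _ _ => Nat.zero_le _) hx
  rw [Int.abs_eq_natAbs]
  exact_mod_cast h1.trans h2

/-- A finite cluster is contained in some box, so escape from every box forces an infinite cluster.
-/
theorem tendsto_perc_escape {p : unitInterval}
    (h : perc d p {ω | (cluster ω 0).Infinite} = 0) :
    Filter.Tendsto (fun n => perc d p (escape (box d n) univ 0)) Filter.atTop (nhds 0) := by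
  have hanti : Antitone fun n => escape (box d n) (univ : Set (Edge d)) 0 := by
    intro m n hmn ω hω
    rw [mem_escape] at *
    obtain ⟨y, hy, hl⟩ := hω
    exact ⟨y, fun hym => hy (box_mono hmn hym), hl⟩
  have hlim := tendsto_measure_iInter_atTop (μ := perc d p)
    (fun n => (measurableSet_escape (box d n) univ 0).nullMeasurableSet) hanti
    ⟨0, measure_ne_top _ _⟩
  have hsub : ⋂ n, escape (box d n) (univ : Set (Edge d)) 0 ⊆ {ω | (cluster ω 0).Infinite} := by
    intro ω hω hfin
    obtain ⟨n, hn⟩ := exists_subset_box hfin.toFinset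
    obtain ⟨y, hy, hl⟩ := mem_escape.1 (mem_iInter.1 hω n)
    exact hy (hn (hfin.mem_toFinset.2 (mem_linked_univ.1 hl)))
  rwa [measure_mono_null hsub h] at hlim

/-- Otherwise `le_perc_escape` bounds the escape probabilities at `p` below, uniformly in the box,
while they tend to `0`. -/
theorem exists_boundarySum_lt_one {q p : unitInterval} (hqp : q < p)
    (h : perc d p {ω | (cluster ω 0).Infinite} = 0) :
    ∃ S : Finset (Vertex d), 0 ∈ S ∧ boundarySum q S < 1 := by
  by_contra! hc
  have h1 := (ENNReal.tendsto_toReal ENNReal.zero_ne_top).comp (tendsto_perc_escape h)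
  simp only [ENNReal.toReal_zero] at h1
  -- An escape probability `θ < (p - q) / 2 ≤ 1 / 2` would give `(1 - θ) * (p - q) > θ`.
  have hpos : (0 : ℝ) < ((p : ℝ) - q) / 2 := by
    have : (q : ℝ) < p := hqp
    linarith
  obtain ⟨n, hn⟩ := (h1.eventually_lt_const hpos).exists
  have h2 := le_perc_escape (Λ := box d n) hqp hc
  have h3 : (perc d p).real (escape (box d n) (edgesAt (box d n)) 0) ≤
      (perc d p).real (escape (box d n) univ 0) :=
    measureReal_mono (escape_mono (subset_univ _) _) (measure_ne_top _ _)
  simp only [Function.comp_apply] at hn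
  change (perc d p).real (escape (box d n) univ 0) < _ at hn
  have h4 : (p : ℝ) ≤ 1 := p.2.2
  have h5 : (0 : ℝ) ≤ q := q.2.1
  nlinarith

/-! ### Decay of connection probabilities -/

/-- The event that `C` is the set of vertices joined to the origin inside `S`, expressed in terms of
the edges that have an end in `C`. -/
def explored (S C : Finset (Vertex d)) : Set (Config d) :=
  (⋂ e ∈ inside (S : Set (Vertex d)) ∩ cut (C : Set (Vertex d)),
    (fun ω : Config d => ω e) ⁻¹' {false}) ∩
  ⋂ y ∈ {y : Vertex d | y ∈ C}, linked (inside (C : Set (Vertex d))) 0 y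

theorem mem_explored {S C : Finset (Vertex d)} {ω : Config d} : ω ∈ explored S C ↔
    (∀ e, e ∈ inside (S : Set (Vertex d)) → e ∈ cut (C : Set (Vertex d)) → ω e = false) ∧
      ∀ y ∈ C, ω ∈ linked (inside (C : Set (Vertex d))) 0 y := by
  simp only [explored, mem_inter_iff, mem_iInter, mem_preimage, mem_singleton_iff, mem_ofPred_eq,
    and_imp]

theorem measurableSet_explored (S C : Finset (Vertex d)) : MeasurableSet (explored S C) :=
  (MeasurableSet.biInter (to_countable _) fun _ _ =>
    measurable_pi_apply _ (measurableSet_singleton _)).inter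
  (MeasurableSet.biInter (to_countable _) fun _ _ => measurableSet_linked _ _ _)

theorem supportedOn_explored (S C : Finset (Vertex d)) :
    SupportedOn (explored S C) (inside (C : Set (Vertex d))ᶜ)ᶜ := by
  refine SupportedOn.inter (SupportedOn.biInter fun e he => ?_) (SupportedOn.biInter fun x _ =>
    (supportedOn_linked _ _ _).mono ?_)
  · intro ω ω' h hω
    have : e ∈ (inside (C : Set (Vertex d))ᶜ)ᶜ := fun hin =>
      he.2 ⟨fun h => absurd h hin.1, fun h => absurd h hin.2⟩
    simpa [h e this] using hω
  · exact fun e he hin => hin.1 he.1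

/-- Hence `ω` determines `C`, and the events for different `C` are disjoint. -/
theorem mem_iff_linked_of_explored {S C : Finset (Vertex d)} {ω : Config d} (hC : C ⊆ S)
    (h0 : 0 ∈ C) (h : ω ∈ explored S C) (y : Vertex d) :
    y ∈ C ↔ ω ∈ linked (inside (S : Set (Vertex d))) 0 y := by
  rw [mem_explored] at h
  constructor
  · have hsub : inside (C : Set (Vertex d)) ⊆ inside (S : Set (Vertex d)) :=
      fun e he => ⟨hC he.1, hC he.2⟩
    exact fun hy => linked_mono hsub _ _ (h.2 y hy)
  · intro hl
    by_contra hy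
    obtain ⟨e, he, hec⟩ := exists_cut_edge_of_reachable (S := (C : Set (Vertex d))) hl h0 hy
    have h1 := h.1 e he.2 hec
    rw [he.1] at h1
    exact absurd h1 (by simp)

theorem exists_explored {S : Finset (Vertex d)} (h0 : 0 ∈ S) (ω : Config d) :
    ∃ C ⊆ S, 0 ∈ C ∧ ω ∈ explored S C := by
  classical
  let C := S.filter fun y => ω ∈ linked (inside (S : Set (Vertex d))) 0 y
  have hC : ∀ y, y ∈ C ↔ y ∈ S ∧ ω ∈ linked (inside (S : Set (Vertex d))) 0 y := fun y =>
    Finset.mem_filter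
  refine ⟨C, Finset.filter_subset _ _, (hC 0).2 ⟨h0, linked_refl _ _ _⟩,
    mem_explored.2 ⟨fun e he hec => ?_, fun y hy => ?_⟩⟩
  · by_contra hω
    have hω' : ω e = true := by simpa using hω
    refine hec ?_
    have hl := linked_edge he hω'
    simp only [Finset.mem_coe, hC]
    exact ⟨fun h => ⟨he.2, linked_trans h.2 hl⟩, fun h => ⟨he.1, linked_trans h.2 (linked_symm hl)⟩⟩
  · have key : ∀ x y, (edgeGraph {e | ω e = true ∧ e ∈ inside (S : Set (Vertex d))}).Walk x y →
        x ∈ C → ω ∈ linked (inside (C : Set (Vertex d))) x y := by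
      intro x y w
      induction w with
      | nil => exact fun _ => linked_refl _ _ _
      | @cons u v z hadj _ ih =>
        intro hu
        have hl : ω ∈ linked (inside (S : Set (Vertex d))) u v := SimpleGraph.Adj.reachable hadj
        obtain ⟨e, he, h⟩ := edgeGraph_adj.1 hadj
        have hv : v ∈ C := by
          refine (hC v).2 ⟨?_, linked_trans ((hC u).1 hu).2 hl⟩
          rcases h with ⟨-, rfl⟩ | ⟨rfl, -⟩
          · exact he.2.2
          · exact he.2.1
        refine linked_trans ?_ (ih hv)
        refine SimpleGraph.Adj.reachable (edgeGraph_adj.2 ⟨e, ⟨he.1, ?_⟩, h⟩)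
        rcases h with ⟨rfl, rfl⟩ | ⟨rfl, rfl⟩
        · exact ⟨hu, hv⟩
        · exact ⟨hv, hu⟩
    obtain ⟨w⟩ := ((hC y).1 hy).2
    exact key _ _ w ((hC 0).2 ⟨h0, linked_refl _ _ _⟩)

open Classical in
/-- The end of `e` outside `S`, for an edge `e` with exactly one end in `S`. -/
noncomputable def outerEnd (S : Finset (Vertex d)) (e : Edge d) : Vertex d :=
  if e.1 ∈ S then e.top else e.1

/-- A path that leaves `C` uses an edge of the boundary of `C`, after which it avoids `C`. -/
theorem exists_last_exit {C : Set (Vertex d)} {x y : Vertex d} {ω : Config d}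
    (h : ω ∈ linked univ x y) (hx : x ∈ C) (hy : y ∉ C) :
    ∃ e, ω e = true ∧ ∃ u ∈ C, ∃ v ∉ C, ((e.1 = u ∧ e.top = v) ∨ (e.1 = v ∧ e.top = u)) ∧
      ω ∈ linked (inside Cᶜ) v y := by
  -- The disjunction strengthens the induction: the first vertex at which it fails along the path
  -- follows the desired exit.
  have key : ∀ x y, (edgeGraph {e | ω e = true ∧ e ∈ univ}).Walk x y → y ∉ C →
      (x ∈ C ∨ ω ∉ linked (inside Cᶜ) x y) →
      ∃ e, ω e = true ∧ ∃ u ∈ C, ∃ v ∉ C, ((e.1 = u ∧ e.top = v) ∨ (e.1 = v ∧ e.top = u)) ∧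
        ω ∈ linked (inside Cᶜ) v y := by
    intro x y w
    induction w with
    | nil => exact fun hy hx => (hx.elim (fun h => absurd h hy) fun h => absurd (linked_refl _ _ _) h)
    | @cons u v z hadj _ ih =>
      intro hz hu
      by_cases hv : v ∈ C ∨ ω ∉ linked (inside Cᶜ) v z
      · exact ih hz hv
      · rw [not_or, not_not] at hv
        obtain ⟨e, he, h⟩ := edgeGraph_adj.1 hadj
        refine ⟨e, he.1, u, ?_, v, hv.1, h, hv.2⟩
        by_contra huC
        refine (hu.resolve_left huC) (linked_trans (SimpleGraph.Adj.reachable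
          (edgeGraph_adj.2 ⟨e, ⟨he.1, ?_⟩, h⟩)) hv.2)
        rcases h with ⟨rfl, rfl⟩ | ⟨rfl, rfl⟩
        · exact ⟨huC, hv.1⟩
        · exact ⟨hv.1, huC⟩
  obtain ⟨w⟩ := h
  exact key x y w hy (Or.inl hx)

/-- The last exit from `C` also leaves `S`, since the edges of the cut of `C` inside `S` are closed.
-/
theorem exists_exit_of_explored {S C : Finset (Vertex d)} {x : Vertex d} {ω : Config d}
    (hC : C ⊆ S) (h0 : 0 ∈ C) (hx : x ∉ S) (h : ω ∈ explored S C) (hl : ω ∈ linked univ 0 x) :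
    ∃ e ∈ cutFinset S, (e.1 ∈ C ∨ e.top ∈ C) ∧
      ω ∈ linked (inside (C : Set (Vertex d))ᶜ) (outerEnd S e) x := by
  obtain ⟨e, he, u, hu, v, hv, huv, hvx⟩ := exists_last_exit (C := (C : Set (Vertex d))) hl h0
    fun hxC => hx (hC hxC)
  have hu' : u ∈ C := hu
  have hvS : v ∉ S := by
    intro hvS
    have := (mem_explored.1 h).1 e ?_ ?_
    · rw [he] at this
      exact absurd this (by simp)
    · rcases huv with ⟨rfl, rfl⟩ | ⟨rfl, rfl⟩
      · exact ⟨hC hu, hvS⟩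
      · exact ⟨hvS, hC hu⟩
    · rcases huv with ⟨rfl, rfl⟩ | ⟨rfl, rfl⟩
      · exact fun h => hv (h.1 hu)
      · exact fun h => hv (h.2 hu)
  refine ⟨e, ?_, ?_, ?_⟩
  · rw [mem_cutFinset]
    rcases huv with ⟨rfl, rfl⟩ | ⟨rfl, rfl⟩
    · exact fun h => hvS (h.1 (hC hu))
    · exact fun h => hvS (h.2 (hC hu))
  · rcases huv with ⟨rfl, rfl⟩ | ⟨rfl, rfl⟩
    · exact Or.inl hu
    · exact Or.inr hu
  · have : outerEnd S e = v := by
      rcases huv with ⟨rfl, rfl⟩ | ⟨rfl, rfl⟩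
      · simp [outerEnd, hC hu']
      · simp [outerEnd, hvS]
    rwa [this]

theorem explored_subset_linkedInside {S C : Finset (Vertex d)} (hC : C ⊆ S) (h0 : 0 ∈ C)
    {e : Edge d} (he : e.1 ∈ C ∨ e.top ∈ C) : explored S C ⊆ linkedInside S e := by
  intro ω hω
  simp only [linkedInside, mem_iUnion, exists_prop]
  rcases he with he | he
  · exact ⟨e.1, ⟨hC he, Or.inl rfl⟩, (mem_iff_linked_of_explored hC h0 hω _).1 he⟩
  · exact ⟨e.top, ⟨hC he, Or.inr rfl⟩, (mem_iff_linked_of_explored hC h0 hω _).1 he⟩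

/-- The Simon inequality. -/
theorem perc_linked_le_sum (p : unitInterval) {S : Finset (Vertex d)} (h0 : 0 ∈ S) {x : Vertex d}
    (hx : x ∉ S) : (perc d p).real (linked univ 0 x) ≤
      ∑ e ∈ cutFinset S, (perc d p).real (linkedInside S e) *
        (perc d p).real (linked univ (outerEnd S e) x) := by
  classical
  let 𝒞 : Edge d → Finset (Finset (Vertex d)) := fun e =>
    S.powerset.filter fun C => (0 : Vertex d) ∈ C ∧ (e.1 ∈ C ∨ e.top ∈ C)
  have h𝒞 : ∀ e, ∀ C ∈ 𝒞 e, C ⊆ S ∧ 0 ∈ C ∧ (e.1 ∈ C ∨ e.top ∈ C) := fun e C hC => by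
    simpa only [𝒞, Finset.mem_filter, Finset.mem_powerset] using hC
  have hcover : linked univ 0 x ⊆ ⋃ e ∈ cutFinset S, ⋃ C ∈ 𝒞 e,
      explored S C ∩ linked (inside (C : Set (Vertex d))ᶜ) (outerEnd S e) x := by
    intro ω hω
    obtain ⟨C, hC, h0C, hexp⟩ := exists_explored h0 ω
    obtain ⟨e, he, heC, hl⟩ := exists_exit_of_explored hC h0C hx hexp hω
    simp only [mem_iUnion]
    exact ⟨e, he, C, by simp only [𝒞, Finset.mem_filter, Finset.mem_powerset]; exact ⟨hC, h0C, heC⟩,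
      hexp, hl⟩
  refine (measureReal_mono hcover (measure_ne_top _ _)).trans
    ((measureReal_biUnion_finset_le _ _).trans (Finset.sum_le_sum fun e _ => ?_))
  refine (measureReal_biUnion_finset_le _ _).trans ?_
  -- The exploration reads only edges touching `C`, while the remaining path avoids them; this
  -- independence replaces a disjoint-occurrence inequality.
  have hind : ∀ C, (perc d p).real (explored S C ∩
      linked (inside (C : Set (Vertex d))ᶜ) (outerEnd S e) x) =
      (perc d p).real (explored S C) *
        (perc d p).real (linked (inside (C : Set (Vertex d))ᶜ) (outerEnd S e) x) := fun C =>
    perc_real_inter (measurableSet_explored _ _) (measurableSet_linked _ _ _)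
      (supportedOn_explored _ _) (supportedOn_linked _ _ _) disjoint_compl_left
  have hle : ∀ C, (perc d p).real (linked (inside (C : Set (Vertex d))ᶜ) (outerEnd S e) x) ≤
      (perc d p).real (linked univ (outerEnd S e) x) := fun C =>
    measureReal_mono (linked_mono (subset_univ _) _ _) (measure_ne_top _ _)
  have hsum : ∑ C ∈ 𝒞 e, (perc d p).real (explored S C) ≤ (perc d p).real (linkedInside S e) := by
    rw [← measureReal_biUnion_finset]
    · refine measureReal_mono (iUnion₂_subset fun C hC => ?_) (measure_ne_top _ _)
      exact explored_subset_linkedInside (h𝒞 e C hC).1 (h𝒞 e C hC).2.1 (h𝒞 e C hC).2.2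
    · intro C hC C' hC' hne
      refine Set.disjoint_left.2 fun ω hω hω' => hne ?_
      ext y
      rw [mem_iff_linked_of_explored (h𝒞 e C hC).1 (h𝒞 e C hC).2.1 hω,
        mem_iff_linked_of_explored (h𝒞 e C' hC').1 (h𝒞 e C' hC').2.1 hω']
    · exact fun C _ => measurableSet_explored _ _
  calc ∑ C ∈ 𝒞 e, (perc d p).real (explored S C ∩
        linked (inside (C : Set (Vertex d))ᶜ) (outerEnd S e) x)
      ≤ ∑ C ∈ 𝒞 e, (perc d p).real (explored S C) *
          (perc d p).real (linked univ (outerEnd S e) x) := by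
        refine Finset.sum_le_sum fun C _ => ?_
        rw [hind]
        exact mul_le_mul_of_nonneg_left (hle C) measureReal_nonneg
    _ ≤ _ := by
        rw [← Finset.sum_mul]
        exact mul_le_mul_of_nonneg_right hsum measureReal_nonneg

theorem perc_linked_translate (p : unitInterval) (x y v : Vertex d) :
    (perc d p).real (linked univ (x + v) (y + v)) = (perc d p).real (linked univ x y) := by
  have h := (measurePreserving_shift p v).measure_preimage
    (measurableSet_linked univ x y).nullMeasurableSet
  have h2 : shift v ⁻¹' linked univ x y = linked univ (x + v) (y + v) := by
    ext ω
    exact shift_mem_linked_univ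
  rw [Measure.real, Measure.real, ← h, h2]

theorem outerEnd_mem_box {S : Finset (Vertex d)} {n : ℕ} (hS : S ⊆ box d n) {e : Edge d}
    (he : e ∈ cutFinset S) : outerEnd S e ∈ box d (n + 1) := by
  rw [mem_cutFinset] at he
  simp only [cut, mem_ofPred_eq, Finset.mem_coe] at he
  rw [mem_box]
  intro k
  have hs : |(Pi.single e.2 1 : Vertex d) k| ≤ 1 := by
    by_cases hk : k = e.2
    · subst hk; simp
    · simp [hk]
  have htop : e.top k = e.1 k + (Pi.single e.2 1 : Vertex d) k := rfl
  push_cast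
  by_cases h1 : e.1 ∈ S
  · have := mem_box.1 (hS h1) k
    simp only [outerEnd, h1, if_true, htop]
    exact (abs_add_le _ _).trans (add_le_add this hs)
  · have h2 : e.top ∈ S := by tauto
    have := mem_box.1 (hS h2) k
    simp only [outerEnd, h1, if_false]
    rw [htop] at this
    rw [abs_le] at *
    constructor <;> omega

/-- The outer end of a cut edge of `S` is in the box of radius `n + 1`, so each use of the Simon
inequality gains a factor `boundarySum p S` and costs at most `n + 1` in distance. -/
theorem perc_linked_le_pow (p : unitInterval) {S : Finset (Vertex d)} (h0 : 0 ∈ S) {n : ℕ}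
    (hS : S ⊆ box d n) (k : ℕ) : ∀ x ∉ box d (k * (n + 1)),
      (perc d p).real (linked univ 0 x) ≤ boundarySum p S ^ k := by
  induction k with
  | zero => exact fun x _ => by simp
  | succ k ih =>
    intro x hx
    have hxS : x ∉ S := fun h => hx (box_mono (by nlinarith) (hS h))
    refine (perc_linked_le_sum p h0 hxS).trans ?_
    rw [pow_succ', boundarySum, Finset.sum_mul]
    refine Finset.sum_le_sum fun e he => mul_le_mul_of_nonneg_left ?_ measureReal_nonneg
    have h1 := perc_linked_translate p 0 (x - outerEnd S e) (outerEnd S e)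
    rw [zero_add, sub_add_cancel] at h1
    rw [h1]
    refine ih _ fun hbox => hx ?_
    have h2 := outerEnd_mem_box hS he
    rw [mem_box] at *
    intro i
    have h3 := hbox i
    have h4 := h2 i
    rw [Pi.sub_apply] at h3
    have h5 := abs_add_le (x i - outerEnd S e i) (outerEnd S e i)
    rw [sub_add_cancel] at h5
    push_cast at *
    linarith

theorem exists_exponential_bound (p : unitInterval) {S : Finset (Vertex d)} (h0 : 0 ∈ S)
    (hlt : boundarySum p S < 1) : ∃ σ < (1 : ℝ), 0 < σ ∧ ∃ L : ℕ, ∀ (i : Fin d) (m : ℕ), 0 < m →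
      (perc d p).real (linked univ 0 (Pi.single i (m : ℤ))) * σ ^ L ≤ σ ^ m := by
  obtain ⟨n, hn⟩ := exists_subset_box S
  -- The maximum with `1 / 2` keeps the rate positive even if the boundary sum vanishes.
  set ρ := max (boundarySum p S) (1 / 2) with hρ
  have hρ1 : ρ < 1 := max_lt hlt (by norm_num)
  have hρ0 : 0 < ρ := lt_of_lt_of_le (by norm_num) (le_max_right _ _)
  have hb0 : 0 ≤ boundarySum p S := Finset.sum_nonneg fun _ _ => measureReal_nonneg
  let σ := ρ ^ ((1 : ℝ) / (n + 1 : ℕ))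
  have hσ0 : 0 < σ := Real.rpow_pos_of_pos hρ0 _
  have hσ1 : σ < 1 := Real.rpow_lt_one hρ0.le hρ1 (by positivity)
  have hσn : σ ^ (n + 1) = ρ := by
    rw [← Real.rpow_natCast, ← Real.rpow_mul hρ0.le, one_div_mul_cancel (by positivity),
      Real.rpow_one]
  refine ⟨σ, hσ1, hσ0, n + 1, fun i m hm => ?_⟩
  -- Using `m - 1` puts the point at distance `m` strictly outside the box of radius `k * (n + 1)`.
  set k := (m - 1) / (n + 1)
  have hk1 : k * (n + 1) ≤ m - 1 := Nat.div_mul_le_self _ _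
  have hk2 : m - 1 < k * (n + 1) + (n + 1) := Nat.lt_div_mul_add (Nat.succ_pos n)
  have hle := perc_linked_le_pow p h0 hn k (Pi.single i (m : ℤ)) (by
    rw [mem_box]
    intro h
    have := h i
    rw [Pi.single_eq_same, Nat.abs_cast] at this
    have : m ≤ k * (n + 1) := by exact_mod_cast this
    omega)
  calc (perc d p).real (linked univ 0 (Pi.single i (m : ℤ))) * σ ^ (n + 1)
      ≤ ρ ^ k * σ ^ (n + 1) := by
        refine mul_le_mul_of_nonneg_right (hle.trans ?_) (by positivity)
        exact pow_le_pow_left₀ hb0 (le_max_left _ _) k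
    _ = σ ^ (k * (n + 1) + (n + 1)) := by rw [← hσn, ← pow_mul, ← pow_add, mul_comm (n + 1) k]
    _ ≤ σ ^ m := pow_le_pow_of_le_one hσ0.le hσ1.le (by omega)

/-! ### Unions of clusters -/

theorem mem_cluster_symm {ω : Config d} {x y : Vertex d} (h : y ∈ cluster ω x) :
    x ∈ cluster ω y := SimpleGraph.Reachable.symm h

theorem mem_cluster_trans {ω : Config d} {x y z : Vertex d} (h : y ∈ cluster ω x)
    (h' : z ∈ cluster ω y) : z ∈ cluster ω x := SimpleGraph.Reachable.trans h h'

theorem mem_cluster_self (ω : Config d) (x : Vertex d) : x ∈ cluster ω x :=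
  SimpleGraph.Reachable.refl _

theorem mem_cluster_of_open {ω : Config d} {e : Edge d} (he : ω e = true) :
    e.top ∈ cluster ω e.1 :=
  SimpleGraph.Adj.reachable (edgeGraph_adj.2 ⟨e, he, Or.inl ⟨rfl, rfl⟩⟩)

/-- The union of the clusters that meet `R`. -/
def clusterUnion (ω : Config d) (R : Set (Vertex d)) : Set (Vertex d) := ⋃ r ∈ R, cluster ω r

theorem mem_clusterUnion {ω : Config d} {R : Set (Vertex d)} {y : Vertex d} :
    y ∈ clusterUnion ω R ↔ ∃ r ∈ R, y ∈ cluster ω r := by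
  simp only [clusterUnion, mem_iUnion, exists_prop]

theorem subset_clusterUnion (ω : Config d) (R : Set (Vertex d)) : R ⊆ clusterUnion ω R :=
  fun r hr => mem_clusterUnion.2 ⟨r, hr, mem_cluster_self ω r⟩

theorem closed_of_mem_cut_clusterUnion {ω : Config d} {R : Set (Vertex d)} {e : Edge d}
    (he : e ∈ cut (clusterUnion ω R)) : ω e = false := by
  by_contra hω
  have h := mem_cluster_of_open (by simpa using hω : ω e = true)
  apply he
  simp only [mem_clusterUnion]
  exact ⟨fun ⟨r, hr, h'⟩ => ⟨r, hr, mem_cluster_trans h' h⟩,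
    fun ⟨r, hr, h'⟩ => ⟨r, hr, mem_cluster_trans h' (mem_cluster_symm h)⟩⟩

/-- Every cluster in the union is connected and meets the connected set `R`. -/
theorem induce_clusterUnion_connected {ω : Config d} {R : Set (Vertex d)} {x : Vertex d}
    (hx : x ∈ R) (hR : R ⊆ compOn (lattice d) R x) :
    ((lattice d).induce (clusterUnion ω R)).Connected := by
  have hxU := subset_clusterUnion ω R hx
  suffices h : clusterUnion ω R ⊆ compOn (lattice d) (clusterUnion ω R) x by
    have := induce_compOn_connected (G := lattice d) hxU
    rwa [(compOn_subset hxU).antisymm h] at this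
  intro y hy
  obtain ⟨r, hr, ⟨w⟩⟩ := mem_clusterUnion.1 hy
  have key : ∀ u v, (openGraph ω).Walk u v → u ∈ compOn (lattice d) (clusterUnion ω R) x →
      v ∈ compOn (lattice d) (clusterUnion ω R) x := by
    intro u v w
    induction w with
    | nil => exact id
    | cons hadj _ ih =>
      intro hu
      refine ih (mem_compOn_of_adj hu (edgeGraph_le_lattice _ hadj) ?_)
      obtain ⟨r, hr, h⟩ := mem_clusterUnion.1 (compOn_subset hxU hu)
      exact mem_clusterUnion.2 ⟨r, hr, mem_cluster_trans h hadj.reachable⟩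
  exact key r y w (compOn_mono (subset_clusterUnion ω R) x (hR hr))

/-- A cluster is connected and all edges of its cut are closed, so it can serve as the set `U` of
`mem_surfaceEvent_of_closed_cut`. -/
theorem mem_surfaceEvent_of_infinite_cluster (hd : 2 ≤ d) {ω : Config d} {x : Vertex d}
    (hinf : (cluster ω x).Infinite) (h : HasInfiniteComponent (cluster ω x)ᶜ) :
    ω ∈ surfaceEvent d := by
  have hU : clusterUnion ω {x} = cluster ω x := by simp [clusterUnion]
  rw [← hU] at hinf h
  refine mem_surfaceEvent_of_closed_cut hd hinf (induce_clusterUnion_connected rfl ?_)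
    (fun e he => closed_of_mem_cut_clusterUnion he) h
  rintro y rfl
  exact self_mem_compOn _ _

theorem range_subset_compOn {V : Type*} {G : SimpleGraph V} {f : ℕ → V}
    (hf : ∀ n, G.Adj (f n) (f (n + 1))) {U : Set V} (hU : range f ⊆ U) :
    range f ⊆ compOn G U (f 0) := by
  rintro _ ⟨n, rfl⟩
  induction n with
  | zero => exact self_mem_compOn _ _
  | succ n ih => exact mem_compOn_of_adj ih (hf n) (hU ⟨n + 1, rfl⟩)

theorem lattice_adj_single (i : Fin d) (a b : ℤ) (h : a + 1 = b ∨ b + 1 = a) :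
    (lattice d).Adj (Pi.single i a) (Pi.single i b) := by
  have : ∀ a : ℤ, (Pi.single i (a + 1) : Vertex d) = Pi.single i a + Pi.single i 1 := by
    intro a
    ext k
    by_cases hk : k = i
    · subst hk; simp
    · simp [hk]
  rcases h with rfl | rfl
  · rw [this]
    exact lattice_adj_top (Pi.single i a, i)
  · rw [this]
    exact (lattice_adj_top (Pi.single i b, i)).symm

/-- If no cluster meets two opposite rays, there is an infinite open surface between the rays. -/
theorem mem_surfaceEvent_of_rays (hd : 2 ≤ d) {ω : Config d} (i : Fin d) (N : ℕ)
    (h : ∀ m n : ℕ, ω ∉ linked univ (Pi.single i (-(m : ℤ))) (Pi.single i ((N + n : ℕ) : ℤ))) :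
    ω ∈ surfaceEvent d := by
  have hinj : Function.Injective fun z : ℤ => (Pi.single i z : Vertex d) :=
    fun a b h => by simpa using congrFun (show (Pi.single i a : Vertex d) = Pi.single i b from h) i
  let f : ℕ → Vertex d := fun m => Pi.single i (-(m : ℤ))
  let g : ℕ → Vertex d := fun n => Pi.single i ((N + n : ℕ) : ℤ)
  have hf : Function.Injective f := hinj.comp fun a b h => by simpa using h
  have hg : Function.Injective g := hinj.comp fun a b h => by
    have : N + a = N + b := by exact_mod_cast h
    omega
  have hf1 : ∀ n, (lattice d).Adj (f n) (f (n + 1)) := fun n =>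
    lattice_adj_single i _ _ (Or.inr (by push_cast; ring))
  have hg1 : ∀ n, (lattice d).Adj (g n) (g (n + 1)) := fun n =>
    lattice_adj_single i _ _ (Or.inl (by push_cast; ring))
  have hgU : range g ⊆ (clusterUnion ω (range f))ᶜ := by
    rintro _ ⟨n, rfl⟩ hn
    obtain ⟨_, ⟨m, rfl⟩, hmn⟩ := mem_clusterUnion.1 hn
    exact h m n (mem_linked_univ.2 hmn)
  refine mem_surfaceEvent_of_closed_cut hd
    ((infinite_range_of_injective hf).mono (subset_clusterUnion ω _))
    (induce_clusterUnion_connected (mem_range_self 0) (range_subset_compOn hf1 Subset.rfl))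
    (fun e he => closed_of_mem_cut_clusterUnion he) ?_
  exact hasInfiniteComponent_iff.2 ⟨g 0, hgU (mem_range_self 0),
    (infinite_range_of_injective hg).mono (range_subset_compOn hg1 hgU)⟩

/-! ### Surfaces with positive probability, and comparison of the critical points -/

theorem perc_surfaceEvent_pos (hd : 2 ≤ d) {p : unitInterval} {S : Finset (Vertex d)} (h0 : 0 ∈ S)
    (hlt : boundarySum p S < 1) : 0 < perc d p (surfaceEvent d) := by
  obtain ⟨σ, hσ1, hσ0, L, hσ⟩ := exists_exponential_bound p h0 hlt
  let i : Fin d := ⟨0, by omega⟩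
  let s := ENNReal.ofReal σ
  have hs1 : s < 1 := by simpa [s] using hσ1
  -- The points `-m` and `N + n` on the axis are at distance `N + n + m`, so the union bound over
  -- connections between the rays is a double geometric series with sum `K * s ^ N`.
  let K : ENNReal := ENNReal.ofReal ((σ ^ L)⁻¹) * ((1 - s)⁻¹ * (1 - s)⁻¹)
  have hK : K ≠ ⊤ := by
    have : (1 - s)⁻¹ ≠ ⊤ := by simpa [tsub_eq_zero_iff_le] using hs1
    exact ENNReal.mul_ne_top ENNReal.ofReal_ne_top (ENNReal.mul_ne_top this this)
  obtain ⟨N, hN0, hN⟩ : ∃ N : ℕ, 0 < N ∧ K * s ^ N < 1 := by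
    have h1 : Filter.Tendsto (fun N : ℕ => K * s ^ N) Filter.atTop (nhds (K * 0)) :=
      ENNReal.Tendsto.const_mul (ENNReal.tendsto_pow_atTop_nhds_zero_of_lt_one hs1) (Or.inr hK)
    rw [mul_zero] at h1
    exact ((Filter.eventually_gt_atTop 0).and (h1.eventually_lt_const one_pos)).exists
  let B : Set (Config d) := ⋃ m : ℕ, ⋃ n : ℕ,
    linked univ (Pi.single i (-(m : ℤ))) (Pi.single i ((N + n : ℕ) : ℤ))
  have hBm : MeasurableSet B := MeasurableSet.iUnion fun m => MeasurableSet.iUnion fun n =>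
    measurableSet_linked _ _ _
  have hterm : ∀ m n : ℕ, perc d p (linked univ (Pi.single i (-(m : ℤ)))
      (Pi.single i ((N + n : ℕ) : ℤ))) ≤ ENNReal.ofReal ((σ ^ L)⁻¹) * s ^ N * s ^ m * s ^ n := by
    intro m n
    -- Translating by `-m` along the axis reduces the connection to one from the origin.
    have h1 := perc_linked_translate p 0 (Pi.single i ((N + n + m : ℕ) : ℤ))
      (Pi.single i (-(m : ℤ)))
    rw [zero_add, ← Pi.single_add, show ((N + n + m : ℕ) : ℤ) + -(m : ℤ) = ((N + n : ℕ) : ℤ) by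
      push_cast; ring] at h1
    have h2 := hσ i (N + n + m) (by omega)
    rw [← h1, ← le_div_iff₀ (by positivity), div_eq_inv_mul] at h2
    rw [← ofReal_measureReal]
    refine (ENNReal.ofReal_le_ofReal h2).trans (le_of_eq ?_)
    rw [ENNReal.ofReal_mul (by positivity), ENNReal.ofReal_pow hσ0.le, pow_add, pow_add]
    simp only [s]
    ring
  have hB : perc d p B < 1 := by
    calc perc d p B ≤ ∑' m : ℕ, ∑' n : ℕ, perc d p (linked univ (Pi.single i (-(m : ℤ)))
            (Pi.single i ((N + n : ℕ) : ℤ))) :=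
          (measure_iUnion_le _).trans (ENNReal.tsum_le_tsum fun m => measure_iUnion_le _)
      _ ≤ ∑' m : ℕ, ∑' n : ℕ, ENNReal.ofReal ((σ ^ L)⁻¹) * s ^ N * s ^ m * s ^ n :=
          ENNReal.tsum_le_tsum fun m => ENNReal.tsum_le_tsum fun n => hterm m n
      _ = K * s ^ N := by
          simp only [ENNReal.tsum_mul_left, ENNReal.tsum_mul_right, ENNReal.tsum_geometric, K]
          ring
      _ < 1 := hN
  have hsub : Bᶜ ⊆ surfaceEvent d := by
    intro ω hω
    refine mem_surfaceEvent_of_rays hd i N fun m n hmn => hω ?_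
    exact mem_iUnion.2 ⟨m, mem_iUnion.2 ⟨n, hmn⟩⟩
  refine lt_of_lt_of_le ?_ (measure_mono hsub)
  rw [prob_compl_eq_one_sub hBm]
  exact tsub_pos_of_lt hB

theorem pFin_le_pSurf (hd : 2 ≤ d) : pFin d ≤ pSurf d := by
  have hfin := isThreshold_pFin (d := d) (by omega)
  have hsurf := isThreshold_pSurf (d := d) (by omega)
  by_contra! hlt
  -- Two parameters are needed: finiteness of clusters is obtained at `p`, and sharpness turns it
  -- into decay only at the smaller `q`.
  obtain ⟨q', h1, h2⟩ := exists_between hlt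
  obtain ⟨p', h3, h4⟩ := exists_between h2
  let q : unitInterval := ⟨q', hsurf.1.1.trans h1.le, h2.le.trans hfin.1.2⟩
  let p : unitInterval := ⟨p', hsurf.1.1.trans (h1.trans h3).le, h4.le.trans hfin.1.2⟩
  have hT := (hfin.2 p).1 h4
  have hS := (hsurf.2 p).2 (h1.trans h3)
  -- No vertex of `X` lies in an infinite cluster, so an infinite component of `X` is contained in
  -- the complement of such a cluster and would yield a surface.
  have hnull : perc d p {ω | (cluster ω 0).Infinite} = 0 := by
    have : ∀ᵐ ω ∂(perc d p), ¬ (cluster ω 0).Infinite := by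
      filter_upwards [hT, hS] with ω hωT hωS hinf
      refine hωS (mem_surfaceEvent_of_infinite_cluster hd hinf (HasInfiniteComponent.mono ?_ hωT))
      intro y hy hy0
      exact hinf (Set.Finite.subset hy fun z hz => mem_cluster_trans (mem_cluster_symm hy0) hz)
    simpa [ae_iff] using this
  obtain ⟨S, h0, hlt⟩ := exists_boundarySum_lt_one (show q < p from h3) hnull
  have hq := (hsurf.2 q).2 h1
  rw [ae_iff] at hq
  simp only [not_not] at hq
  exact (perc_surfaceEvent_pos hd h0 hlt).ne' hq

end PlaquettePercolation

open PlaquettePercolation in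
theorem theorem2 (d : ℕ) (hd : 2 ≤ d) :
    IsThreshold (finiteClustersEvent d) (pFin d) ∧
    IsThreshold (surfaceEvent d) (pSurf d) ∧
    pFin d ≤ pSurf d ∧
    ∀ (ω : Config d) (x : Vertex d), (cluster ω x).Infinite →
      HasInfiniteComponent (cluster ω x)ᶜ → ω ∈ surfaceEvent d :=
  ⟨isThreshold_pFin (by omega), isThreshold_pSurf (by omega), pFin_le_pSurf hd,
    fun _ _ hinf h => mem_surfaceEvent_of_infinite_cluster hd hinf h⟩
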